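/- **Signatures.** A signature of arity $n$ is a function $F:\{0,1\}^n\to\mathbb{C}$, regarded as a vector in $(\mathbb{C}^2)^{\otimes n}$. It is degenerate if $F=u_1\otimes\cdots\otimes u_n$ for some $u_1,\dots,u_n\in\mathbb{C}^2$. The symmetric signature $f=[f_0,f_1,\dots,f_n]$ takes the value $f_w$ on every input of Hamming weight $w$; it is given by the $n+1$ numbers $f_0,\dots,f_n$. Let $\mathbf{O}_2(\mathbb{C})=\{H\in\mathbb{C}^{2\times 2}: H^{\mathsf T}H=I\}$ and $\alpha=e^{\pi i/4}$. For $H\in\mathbf{O}_2(\mathbb{C})$ we say that a symmetric signature $f$ of arity $n$ is in $\mathscr{A}_k$ with transformation $H$ if, for some $c\in\mathbb{C}\setminus\{0\}$, - ($k=1$) $f=c\,H^{\otimes n}\left(\binom{1}{1}^{\otimes n}+\alpha^{tn+2r}\binom{1}{-1}^{\otimes n}\right)$ for some $t\in\{0,1\}$, $r\in\{0,1,2,3\}$; - ($k=2$) $f=c\,H^{\otimes n}\left(\binom{1}{i}^{\otimes n}+\binom{1}{-i}^{\otimes n}\right)$; - ($k=3$) $f=c\,H^{\otimes n}\left(\binom{1}{\alpha}^{\otimes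 n}+i^{r}\binom{1}{-\alpha}^{\otimes n}\right)$ for some $r\in\{0,1,2,3\}$. We write $f\in\mathscr{A}_k$ if such an $H\in\mathbf{O}_2(\mathbb{C})$ exists. **Algorithms.** An algorithm is a single finite program, independent of the input, for a random access machine with exact complex arithmetic: it has registers for natural numbers (reset, increment, decrement, copy, equality test), registers and an indexed array for complex numbers (the constants $1$ and $i$, the operations $+,-,\times,/$, the principal $m$-th root where $m$ is the content of a natural number register, load, store, test for zero), sequencing, branching and loops. In the unit-cost measure every instruction and test costs $1$. In the bit-cost measure, used when all inputs are algebraic numbers, an instruction that writes a complex number $z$ costs $1$ plus the bit size of $z$, and every other instruction or test costs $1$; here the bit size of an algebraic number is the bit length of a shortest nonzero integer polynomial vanishing at it, written densely. **Lemma.** Let $f=[f_0,\dots,f_n]$ be a non-degenerate symmetric signature of arity $n\ge 3$. Then $f\in\mathscr{A}_k$ for at most one $k\in\{1,2,3\}$. Moreover there are a single algorithm and a polynomial $p$ such that, for every $n\geq 3$ and every such $f$, the algorithm on input $n,f_0,\dots,f_n$ halts, decides for each $k\in\{1,2,3\}$ whether $f\in\mathscr{A}_k$, and, if $f\in\mathscr{A}_k$,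 outputs a matrix $H\in\mathbf{O}_2(\mathbb{C})$ such that $f\in\mathscr{A}_k$ with transformation $H$. Its unit cost is at most $p(n)$ for all complex $f_0,\dots,f_n$; and if $f_0,\dots,f_n$ are algebraic, its bit cost is at most $p(n+L)$, where $L$ is the sum of the bit sizes of $f_0,\dots,f_n$. -/

import Mathlib

noncomputable section

namespace Holant

/-! ### Signatures -/

/-- A (Boolean, complex-valued) signature of arity `n`: a function on `{0,1}^n`, that is, a vector
in `(ℂ²)^{⊗n}`. -/
abbrev Signature (n : ℕ) := (Fin n → Fin 2) → ℂ

/-- The symmetric signature `[f₀, f₁, …, fₙ]`: its value on `x` is `f_w`, where `w` is the Hamming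
weight of `x`. -/
def symm {n : ℕ} (f : Fin (n + 1) → ℂ) : Signature n := fun x =>
  f ⟨(Finset.univ.filter fun i => x i = 1).card,
    Nat.lt_succ_of_le ((Finset.card_le_univ _).trans (Fintype.card_fin n).le)⟩

/-- The tensor product `u₁ ⊗ ⋯ ⊗ uₙ` of unary signatures. -/
def tensor {n : ℕ} (u : Fin n → Fin 2 → ℂ) : Signature n := fun x => ∏ i, u i (x i)

/-- The tensor power `v^{⊗n}`. -/
def tensorPow (n : ℕ) (v : Fin 2 → ℂ) : Signature n := tensor fun _ => v

/-- The product `H^{⊗n} F`. -/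
def transform {n : ℕ} (H : Matrix (Fin 2) (Fin 2) ℂ) (F : Signature n) : Signature n :=
  fun x => ∑ y : Fin n → Fin 2, (∏ i, H (x i) (y i)) * F y

/-- A signature is degenerate if it is a tensor product of unary signatures. -/
def IsDegenerate {n : ℕ} (F : Signature n) : Prop := ∃ u : Fin n → Fin 2 → ℂ, F = tensor u

/-- `α = e^{πi/4}`, a square root of the imaginary unit. -/
def alpha : ℂ := Complex.exp (Real.pi * Complex.I / 4)

/-- The canonical forms of `𝒜₁`, `𝒜₂`, `𝒜₃` in arity `n`, up to a nonzero scalar. -/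
def canonical (k n : ℕ) : Set (Signature n) :=
  match k with
  | 1 => {F | ∃ t r : ℕ, t ≤ 1 ∧ r ≤ 3 ∧
      F = tensorPow n ![1, 1] + alpha ^ (t * n + 2 * r) • tensorPow n ![1, -1]}
  | 2 => {tensorPow n ![1, Complex.I] + tensorPow n ![1, -Complex.I]}
  | 3 => {F | ∃ r : ℕ, r ≤ 3 ∧
      F = tensorPow n ![1, alpha] + Complex.I ^ r • tensorPow n ![1, -alpha]}
  | _ => ∅

/-- `f ∈ 𝒜_k` with the transformation `H`, where `H ∈ O₂(ℂ)` (the complex orthogonal group,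
defined by the transpose without conjugation). -/
def MemAWith (k : ℕ) {n : ℕ} (f : Fin (n + 1) → ℂ) (H : Matrix (Fin 2) (Fin 2) ℂ) : Prop :=
  H.transpose * H = 1 ∧
    ∃ c : ℂ, c ≠ 0 ∧ ∃ F ∈ canonical k n, symm f = c • transform H F

/-- `f ∈ 𝒜_k`. -/
def MemA (k : ℕ) {n : ℕ} (f : Fin (n + 1) → ℂ) : Prop := ∃ H, MemAWith k f H

/-! ### Random access machine with exact complex arithmetic -/

/-- A machine state: index registers holding natural numbers, scalar registers holding complex
numbers, and an array of complex numbers. -/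
structure State where
  idx : ℕ → ℕ
  var : ℕ → ℂ
  arr : ℕ → ℂ

/-- The four field operations. -/
inductive ArithOp
  | add | sub | mul | div

/-- Semantics of the field operations (a division by zero returns zero). -/
def ArithOp.eval : ArithOp → ℂ → ℂ → ℂ
  | .add, x, y => x + y
  | .sub, x, y => x - y
  | .mul, x, y => x * y
  | .div, x, y => x / y

/-- Elementary instructions. Arguments are names of registers, the destination first. On index
registers there are only reset, increment, decrement and copy, so that their contents cannot exceed
the initial contents by more than the number of steps. -/
inductive Instr
  | idxZero (i : ℕ)
  | idxInc (i : ℕ)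
  | idxDec (i : ℕ)
  | idxCopy (i j : ℕ)
  | one (x : ℕ)
  | imag (x : ℕ)
  | arith (op : ArithOp) (x y z : ℕ)
  | root (x y i : ℕ)
  | load (x i : ℕ)
  | store (i x : ℕ)

/-- The effect of an elementary instruction. Here `root x y i` puts the principal `m`-th root of
scalar `y` into scalar `x`, with `m` the content of index register `i`; `load` and `store` access
the array at the position given by an index register. -/
def Instr.next : Instr → State → State
  | .idxZero i, s => { s with idx := Function.update s.idx i 0 }
  | .idxInc i, s => { s with idx := Function.update s.idx i (s.idx i + 1) }
  | .idxDec i, s => { s with idx := Function.update s.idx i (s.idx i - 1) }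
  | .idxCopy i j, s => { s with idx := Function.update s.idx i (s.idx j) }
  | .one x, s => { s with var := Function.update s.var x 1 }
  | .imag x, s => { s with var := Function.update s.var x Complex.I }
  | .arith op x y z, s => { s with var := Function.update s.var x (op.eval (s.var y) (s.var z)) }
  | .root x y i, s =>
      { s with var := Function.update s.var x (s.var y ^ ((s.idx i : ℂ)⁻¹)) }
  | .load x i, s => { s with var := Function.update s.var x (s.arr (s.idx i)) }
  | .store i x, s => { s with arr := Function.update s.arr (s.idx i) (s.var x) }

/-- The cost of an elementary instruction: one unit, plus the weight `w z` if it writes the complex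
number `z`. -/
def Instr.cost (w : ℂ → ℕ) (a : Instr) (s : State) : ℕ :=
  match a with
  | .idxZero _ | .idxInc _ | .idxDec _ | .idxCopy _ _ => 1
  | .one x | .imag x | .arith _ x _ _ | .root x _ _ | .load x _ => 1 + w ((a.next s).var x)
  | .store _ x => 1 + w (s.var x)

/-- Tests: equality of two index registers, vanishing of a scalar register. -/
inductive Test
  | idxEq (i j : ℕ)
  | isZero (x : ℕ)

def Test.Holds : Test → State → Prop
  | .idxEq i j, s => s.idx i = s.idx j
  | .isZero x, s => s.var x = 0

/-- Programs: finite texts built from elementary instructions by composition, branching, and loops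
(`loopUntil b c` repeats `c` until the test `b` holds). -/
inductive Program
  | instr (a : Instr)
  | comp (c d : Program)
  | branch (b : Test) (c d : Program)
  | loopUntil (b : Test) (c : Program)

/-- `Runs w c s s₁ t`: started in state `s`, the program `c` halts in state `s₁` at total cost `t`,
where writing the complex number `z` costs `1 + w z`, and index instructions and tests cost `1`. -/
inductive Runs (w : ℂ → ℕ) : Program → State → State → ℕ → Prop
  | instr (a : Instr) (s : State) : Runs w (.instr a) s (a.next s) (a.cost w s)
  | comp {c d : Program} {s s₁ s₂ : State} {t t₁ : ℕ} :
      Runs w c s s₁ t → Runs w d s₁ s₂ t₁ → Runs w (.comp c d) s s₂ (t + t₁)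
  | branch_true {b : Test} {c d : Program} {s s₁ : State} {t : ℕ} :
      b.Holds s → Runs w c s s₁ t → Runs w (.branch b c d) s s₁ (1 + t)
  | branch_false {b : Test} {c d : Program} {s s₁ : State} {t : ℕ} :
      ¬ b.Holds s → Runs w d s s₁ t → Runs w (.branch b c d) s s₁ (1 + t)
  | loop_exit {b : Test} {c : Program} {s : State} :
      b.Holds s → Runs w (.loopUntil b c) s s 1
  | loop_next {b : Test} {c : Program} {s s₁ s₂ : State} {t t₁ : ℕ} :
      ¬ b.Holds s → Runs w c s s₁ t → Runs w (.loopUntil b c) s₁ s₂ t₁ →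
        Runs w (.loopUntil b c) s s₂ (1 + t + t₁)

/-- Unit cost: every elementary step costs one. -/
def unitWeight : ℂ → ℕ := fun _ => 0

/-- The bit length of a (densely written) integer polynomial. -/
def polyBits (p : Polynomial ℤ) : ℕ :=
  ∑ i ∈ Finset.range (p.natDegree + 1), (1 + Nat.size (p.coeff i).natAbs)

/-- The bit size of an algebraic number: the bit length of a shortest nonzero integer polynomial
that vanishes at it. (Only used for algebraic numbers.) -/
def bitSize (z : ℂ) : ℕ :=
  sInf {b : ℕ | ∃ p : Polynomial ℤ, p ≠ 0 ∧ Polynomial.aeval z p = 0 ∧ polyBits p = b}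

/-- The initial state on input `[f₀, …, fₙ]`: index register `0` contains `n`, the array contains
`f₀, …, fₙ`, and everything else is zero. -/
def inputState {n : ℕ} (f : Fin (n + 1) → ℂ) : State where
  idx := fun i => if i = 0 then n else 0
  var := fun _ => 0
  arr := fun j => if h : j < n + 1 then f ⟨j, h⟩ else 0

/-- The `2 × 2` matrix contained in the scalar registers `0, 1, 2, 3`. -/
def State.outputMatrix (s : State) : Matrix (Fin 2) (Fin 2) ℂ :=
  !![s.var 0, s.var 1; s.var 2, s.var 3]

end Holant

end

noncomputable section

namespace Holant

section

open Matrix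

/-! ### Symmetric signatures of tensor rank two -/

/-! Every member of a class is c₁u^{⊗n} + c₂v^{⊗n} with u, v independent, and for n ≥ 3 such a
decomposition is unique up to order and scaling (`Decomposes.unique`). Orthogonal maps preserve the
bilinear form `dot₂`, so the class can be read off the inner products of u, v and the coefficients
(`Criterion`): u, v are orthogonal and non-isotropic for 𝒜₁, both isotropic for 𝒜₂, and
non-isotropic with (u·v)² = −(u·u)(v·v) for 𝒜₃. These conditions exclude each other
(`Criterion.eq`). For 𝒜₁ and 𝒜₃ there is also a condition on the fourth power of the ratio of the
normalized coefficients. Conversely, `memAWith_one`, `memAWith_two` and `memAWith_three` build H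
explicitly from a decomposition that meets the criterion.

To find the decomposition, note that the entries obey a linear recurrence of order two whose
coefficients are minors in f₀, …, f₃; the quadratic formula gives the two slopes. If f₀f₂ − f₁² = 0,
one vector is a multiple of (0,1) and the other is read off f₀, f₁. The resulting candidate is
compared with all entries: a mismatch excludes every class, and agreement together with
non-degeneracy makes it a decomposition.

The program has a single loop, of n rounds, and is straight-line code with branches otherwise. For
the bit cost, algebraic numbers are represented as eigenvalues of integer matrices over a common
denominator (`IsEigen`): Kronecker constructions give sums and products, and A^j gives z^j without
enlarging the matrix. The loop registers have closed forms involving only j-th powers (`LoopInv`),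
so sizes do not compound from round to round. `SizeModel` abstracts what is needed, so that
`exists_runs_decideA` covers both cost measures with one final state. -/

/-- The Hamming weight of an input. -/
def hammingWeight {n : ℕ} (x : Fin n → Fin 2) : ℕ := (Finset.univ.filter fun i => x i = 1).card

lemma hammingWeight_le {n : ℕ} (x : Fin n → Fin 2) : hammingWeight x ≤ n :=
  (Finset.card_le_univ _).trans (Fintype.card_fin n).le

lemma exists_hammingWeight_eq {n j : ℕ} (hj : j ≤ n) :
    ∃ x : Fin n → Fin 2, hammingWeight x = j := by
  obtain ⟨s, -, hs⟩ := Finset.exists_subset_card_eq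
    (s := (Finset.univ : Finset (Fin n))) (n := j) (by simpa using hj)
  refine ⟨fun i => if i ∈ s then 1 else 0, ?_⟩
  rw [← hs, hammingWeight]
  congr 1
  ext i
  simp

lemma tensorPow_apply {n : ℕ} (v : Fin 2 → ℂ) (x : Fin n → Fin 2) :
    tensorPow n v x = v 0 ^ (n - hammingWeight x) * v 1 ^ hammingWeight x := by
  have h : ∀ i, v (x i) = if x i = 1 then v 1 else v 0 := by
    intro i
    rcases Fin.exists_fin_two.mp ⟨x i, rfl⟩ with h | h <;> simp [h]
  have hc : (Finset.univ.filter fun i => ¬ x i = 1).card = n - hammingWeight x := by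
    have := Finset.card_filter_add_card_filter_not (s := (Finset.univ : Finset (Fin n)))
      (fun i => x i = 1)
    rw [Finset.card_univ, Fintype.card_fin] at this
    unfold hammingWeight
    omega
  unfold tensorPow tensor
  simp_rw [h]
  rw [Finset.prod_ite, Finset.prod_const, Finset.prod_const, hc, mul_comm]
  rfl

/-- The signature `[f₀, …, fₙ]` is `c₁ u^{⊗n} + c₂ v^{⊗n}`. -/
def IsSum {n : ℕ} (f : Fin (n + 1) → ℂ) (c₁ : ℂ) (u : Fin 2 → ℂ) (c₂ : ℂ) (v : Fin 2 → ℂ) : Prop :=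
  ∀ j : Fin (n + 1), f j =
    c₁ * (u 0 ^ (n - j : ℕ) * u 1 ^ (j : ℕ)) + c₂ * (v 0 ^ (n - j : ℕ) * v 1 ^ (j : ℕ))

lemma isSum_iff {n : ℕ} {f : Fin (n + 1) → ℂ} {c₁ c₂ : ℂ} {u v : Fin 2 → ℂ} :
    IsSum f c₁ u c₂ v ↔ symm f = c₁ • tensorPow n u + c₂ • tensorPow n v := by
  constructor
  · intro h
    ext x
    have := h ⟨hammingWeight x, Nat.lt_succ_of_le (hammingWeight_le x)⟩
    rw [Pi.add_apply, Pi.smul_apply, Pi.smul_apply, tensorPow_apply, tensorPow_apply]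
    exact this
  · intro h j
    obtain ⟨x, hx⟩ := exists_hammingWeight_eq (Nat.lt_succ_iff.mp j.2)
    have h1 := congrFun h x
    have h2 : symm f x = f j := congrArg f (Fin.ext hx)
    rw [h2] at h1
    simpa [tensorPow_apply, hx] using h1

lemma IsSum.swap {n : ℕ} {f : Fin (n + 1) → ℂ} {c₁ c₂ : ℂ} {u v : Fin 2 → ℂ}
    (h : IsSum f c₁ u c₂ v) : IsSum f c₂ v c₁ u := fun j => by rw [h j, add_comm]

lemma transform_tensorPow {n : ℕ} (H : Matrix (Fin 2) (Fin 2) ℂ) (v : Fin 2 → ℂ) :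
    transform H (tensorPow n v) = tensorPow n (H *ᵥ v) := by
  ext x
  simp only [transform, tensorPow, tensor, mulVec, dotProduct]
  rw [Finset.prod_univ_sum, Fintype.piFinset_univ]
  simp_rw [Finset.prod_mul_distrib]

lemma transform_add_smul {n : ℕ} (H : Matrix (Fin 2) (Fin 2) ℂ) (F G : Signature n) (ε : ℂ) :
    transform H (F + ε • G) = transform H F + ε • transform H G := by
  ext x
  simp only [transform, Pi.add_apply, Pi.smul_apply, smul_eq_mul, Finset.mul_sum,
    ← Finset.sum_add_distrib]
  exact Finset.sum_congr rfl fun y _ => by ring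

lemma isDegenerate_of_eq_tensorPow {n : ℕ} (hn : n ≠ 0) {F : Signature n} {c : ℂ} {u : Fin 2 → ℂ}
    (h : F = c • tensorPow n u) : IsDegenerate F := by
  -- An n-th root of the scalar is absorbed into each of the n factors.
  refine ⟨fun _ => (c ^ ((n : ℂ)⁻¹)) • u, ?_⟩
  rw [h]
  ext x
  simp [tensorPow, tensor, Finset.prod_mul_distrib, Complex.cpow_nat_inv_pow _ hn]

lemma tensorPow_smul {n : ℕ} (c : ℂ) (u : Fin 2 → ℂ) :
    tensorPow n (c • u) = c ^ n • tensorPow n u := by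
  ext x
  simp [tensorPow, tensor, Finset.prod_mul_distrib]

/-- The determinant of the matrix with columns `u`, `v`. -/
def det₂ (u v : Fin 2 → ℂ) : ℂ := u 0 * v 1 - u 1 * v 0

lemma exists_smul_of_det₂_eq_zero {u p : Fin 2 → ℂ} (hu : u ≠ 0) (h : det₂ u p = 0) :
    ∃ κ : ℂ, p = κ • u := by
  unfold det₂ at h
  by_cases h0 : u 0 = 0
  · have h1 : u 1 ≠ 0 := by
      intro h1
      exact hu (by ext i; fin_cases i <;> simp [h0, h1])
    refine ⟨p 1 / u 1, ?_⟩
    have : p 0 = 0 := by simpa [h0, h1] using h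
    ext i; fin_cases i <;> simp [h0, h1, this]
  · refine ⟨p 0 / u 0, ?_⟩
    ext i; fin_cases i
    · simp [h0]
    · simp; field_simp; linear_combination h

lemma det₂_ne_zero_left {u v : Fin 2 → ℂ} (h : det₂ u v ≠ 0) : u ≠ 0 := by
  rintro rfl; simp [det₂] at h

lemma det₂_swap (u v : Fin 2 → ℂ) : det₂ v u = -det₂ u v := by unfold det₂; ring

/-- A decomposition of a signature into two tensor powers of independent vectors. -/
structure Decomposes {n : ℕ} (f : Fin (n + 1) → ℂ) (c₁ : ℂ) (u : Fin 2 → ℂ) (c₂ : ℂ)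
    (v : Fin 2 → ℂ) : Prop where
  isSum : IsSum f c₁ u c₂ v
  left_ne : c₁ ≠ 0
  right_ne : c₂ ≠ 0
  det_ne : det₂ u v ≠ 0

lemma Decomposes.swap {n : ℕ} {f : Fin (n + 1) → ℂ} {c₁ c₂ : ℂ} {u v : Fin 2 → ℂ}
    (h : Decomposes f c₁ u c₂ v) : Decomposes f c₂ v c₁ u :=
  ⟨h.isSum.swap, h.right_ne, h.left_ne, by rw [det₂_swap]; exact neg_ne_zero.mpr h.det_ne⟩

/-- If a coefficient or the determinant vanished, the sum would collapse to a multiple of one tensor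
power. Hence the algorithm never has to test independence. -/
lemma IsSum.decomposes {n : ℕ} {f : Fin (n + 1) → ℂ} {c₁ c₂ : ℂ} {u v : Fin 2 → ℂ} (hn : n ≠ 0)
    (hf : ¬ IsDegenerate (symm f)) (h : IsSum f c₁ u c₂ v) : Decomposes f c₁ u c₂ v := by
  have key := isSum_iff.mp h
  refine ⟨h, ?_, ?_, fun h0 => hf ?_⟩
  · rintro rfl
    exact hf (isDegenerate_of_eq_tensorPow hn (c := c₂) (u := v) (by simpa using key))
  · rintro rfl
    exact hf (isDegenerate_of_eq_tensorPow hn (c := c₁) (u := u) (by simpa using key))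
  · by_cases hu : u = 0
    · subst hu
      have : tensorPow n (0 : Fin 2 → ℂ) = 0 := by
        ext x; simp [tensorPow, tensor, hn]
      exact isDegenerate_of_eq_tensorPow hn (c := c₂) (u := v) (by simpa [this] using key)
    · obtain ⟨κ, rfl⟩ := exists_smul_of_det₂_eq_zero hu h0
      refine isDegenerate_of_eq_tensorPow hn (c := c₁ + c₂ * κ ^ n) (u := u) ?_
      rw [key, tensorPow_smul, add_smul, smul_smul]

/-- Two tensor powers of independent vectors are linearly independent. -/
lemma eq_zero_of_sum_pow_eq_zero {m : ℕ} (hm : 1 ≤ m) {A B : ℂ} {p q : Fin 2 → ℂ}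
    (hpq : det₂ p q ≠ 0)
    (h : ∀ j ≤ m, A * (p 0 ^ (m - j) * p 1 ^ j) + B * (q 0 ^ (m - j) * q 1 ^ j) = 0) : A = 0 := by
  -- Pairing consecutive entries with (q 1, −q 0) kills the q-part and lowers the degree by one; the
  -- two extreme values of j then force p = 0 unless A = 0.
  have key : ∀ j, j + 1 ≤ m → A * det₂ p q * (p 0 ^ (m - 1 - j) * p 1 ^ j) = 0 := by
    intro j hj
    have h1 := h j (by omega)
    have h2 := h (j + 1) hj
    have e1 : m - j = m - 1 - j + 1 := by omega
    have e2 : m - (j + 1) = m - 1 - j := by omega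
    rw [e1] at h1
    rw [e2] at h2
    unfold det₂
    linear_combination q 1 * h1 - q 0 * h2
  by_contra hA
  have k0 := key 0 hm
  have k1 := key (m - 1) (by omega)
  simp [hA, hpq] at k0 k1
  exact det₂_ne_zero_left hpq (by ext i; fin_cases i <;> simp [k0.1, k1.1])

/-- Contracting with the quadratic form that vanishes at u and v kills the first decomposition and
leaves powers of p and q of degree n − 2. Since n − 2 ≥ 1, these are still independent, so the form
vanishes at p as well: p is parallel to u or to v. -/
lemma Decomposes.det₂_mul_det₂_eq_zero {n : ℕ} (hn : 3 ≤ n) {f : Fin (n + 1) → ℂ}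
    {c₁ c₂ d₁ d₂ : ℂ} {u v p q : Fin 2 → ℂ} (h : Decomposes f c₁ u c₂ v)
    (h' : Decomposes f d₁ p d₂ q) : det₂ u p * det₂ v p = 0 := by
  have key : d₁ * (det₂ u p * det₂ v p) = 0 := by
    refine eq_zero_of_sum_pow_eq_zero (m := n - 2) (B := d₂ * (det₂ u q * det₂ v q))
      (by omega) h'.det_ne fun j hj => ?_
    have e0 : n - j = n - 2 - j + 2 := by omega
    have e1 : n - (j + 1) = n - 2 - j + 1 := by omega
    have e2 : n - (j + 2) = n - 2 - j := by omega
    have a0 := (h.isSum ⟨j, by omega⟩).symm.trans (h'.isSum ⟨j, by omega⟩)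
    have a1 := (h.isSum ⟨j + 1, by omega⟩).symm.trans (h'.isSum ⟨j + 1, by omega⟩)
    have a2 := (h.isSum ⟨j + 2, by omega⟩).symm.trans (h'.isSum ⟨j + 2, by omega⟩)
    simp only [e0, e1, e2] at a0 a1 a2
    unfold det₂
    linear_combination (-(u 1 * v 1)) * a0 + (u 0 * v 1 + u 1 * v 0) * a1 - (u 0 * v 0) * a2
  exact (mul_eq_zero.mp key).resolve_left h'.left_ne

/-- With p parallel to u, independence of p and q prevents q from being parallel to u, so q is
parallel to v; independence of the tensor powers then matches the coefficients. -/
lemma Decomposes.unique_aux {n : ℕ} (hn : 3 ≤ n) {f : Fin (n + 1) → ℂ}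
    {c₁ c₂ d₁ d₂ : ℂ} {u v p q : Fin 2 → ℂ} (h : Decomposes f c₁ u c₂ v)
    (h' : Decomposes f d₁ p d₂ q) (hp : det₂ u p = 0) :
    ∃ κ κ' : ℂ, p = κ • u ∧ q = κ' • v ∧ c₁ = d₁ * κ ^ n ∧ c₂ = d₂ * κ' ^ n := by
  obtain ⟨κ, hκ⟩ := exists_smul_of_det₂_eq_zero (det₂_ne_zero_left h.det_ne) hp
  have hq : det₂ v q = 0 := by
    refine (mul_eq_zero.mp (h.det₂_mul_det₂_eq_zero hn h'.swap)).resolve_left fun hq => ?_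
    obtain ⟨κ', hκ'⟩ := exists_smul_of_det₂_eq_zero (det₂_ne_zero_left h.det_ne) hq
    exact h'.det_ne (by simp [hκ, hκ', det₂]; ring)
  obtain ⟨κ', hκ'⟩ := exists_smul_of_det₂_eq_zero (det₂_ne_zero_left h.swap.det_ne) hq
  have key : ∀ j ≤ n, (c₁ - d₁ * κ ^ n) * (u 0 ^ (n - j) * u 1 ^ j) +
      (c₂ - d₂ * κ' ^ n) * (v 0 ^ (n - j) * v 1 ^ j) = 0 := by
    intro j hj
    have e := (h.isSum ⟨j, by omega⟩).symm.trans (h'.isSum ⟨j, by omega⟩)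
    have hs : ∀ x : ℂ, x ^ n = x ^ (n - j) * x ^ j := fun x => by
      rw [← pow_add]; congr 1; omega
    simp only [hκ, hκ', Pi.smul_apply, smul_eq_mul, mul_pow] at e
    rw [hs κ, hs κ']
    linear_combination e
  refine ⟨κ, κ', hκ, hκ', sub_eq_zero.mp ?_, sub_eq_zero.mp ?_⟩
  · exact eq_zero_of_sum_pow_eq_zero (m := n) (by omega) h.det_ne key
  · exact eq_zero_of_sum_pow_eq_zero (m := n) (by omega) h.swap.det_ne fun j hj => by
      rw [add_comm]; exact key j hj

/-- The decomposition is unique up to the order and the scale of the two vectors. -/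
lemma Decomposes.unique {n : ℕ} (hn : 3 ≤ n) {f : Fin (n + 1) → ℂ}
    {c₁ c₂ d₁ d₂ : ℂ} {u v p q : Fin 2 → ℂ} (h : Decomposes f c₁ u c₂ v)
    (h' : Decomposes f d₁ p d₂ q) :
    (∃ κ κ' : ℂ, p = κ • u ∧ q = κ' • v ∧ c₁ = d₁ * κ ^ n ∧ c₂ = d₂ * κ' ^ n) ∨
    (∃ κ κ' : ℂ, p = κ • v ∧ q = κ' • u ∧ c₂ = d₁ * κ ^ n ∧ c₁ = d₂ * κ' ^ n) := by
  rcases mul_eq_zero.mp (h.det₂_mul_det₂_eq_zero hn h') with hp | hp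
  · exact Or.inl (h.unique_aux hn h' hp)
  · exact Or.inr (h.swap.unique_aux hn h' hp)

end

section

open Matrix

/-! ### The classes `𝒜₁`, `𝒜₂`, `𝒜₃` in terms of a decomposition -/

lemma alpha_sq : alpha ^ 2 = Complex.I := by
  rw [alpha, ← Complex.exp_nat_mul, show ((2 : ℕ) : ℂ) * (Real.pi * Complex.I / 4) = Real.pi / 2 * Complex.I by
    push_cast; ring, Complex.exp_pi_div_two_mul_I]

lemma alpha_pow_four : alpha ^ 4 = -1 := by
  rw [show alpha ^ 4 = (alpha ^ 2) ^ 2 by ring, alpha_sq, Complex.I_sq]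

lemma alpha_ne_zero : alpha ≠ 0 := Complex.exp_ne_zero _

/-- The canonical vectors of `𝒜_k` are `(1, ±base k)`. -/
def base (k : ℕ) : ℂ :=
  match k with
  | 1 => 1
  | 2 => Complex.I
  | _ => alpha

/-- The coefficients of the second canonical vector that `𝒜_k` admits in arity `n`. -/
def phases (k n : ℕ) : Set ℂ :=
  match k with
  | 1 => {ε | ∃ t r : ℕ, t ≤ 1 ∧ r ≤ 3 ∧ ε = alpha ^ (t * n + 2 * r)}
  | 2 => {1}
  | _ => {ε | ∃ r : ℕ, r ≤ 3 ∧ ε = Complex.I ^ r}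

lemma canonical_eq {k n : ℕ} (hk : k ∈ ({1, 2, 3} : Finset ℕ)) :
    canonical k n =
      (fun ε => tensorPow n ![1, base k] + ε • tensorPow n ![1, -base k]) '' phases k n := by
  simp only [Finset.mem_insert, Finset.mem_singleton] at hk
  rcases hk with rfl | rfl | rfl
  · ext F
    constructor
    · rintro ⟨t, r, ht, hr, rfl⟩
      exact ⟨_, ⟨t, r, ht, hr, rfl⟩, rfl⟩
    · rintro ⟨_, ⟨t, r, ht, hr, rfl⟩, rfl⟩
      exact ⟨t, r, ht, hr, rfl⟩
  · simp [canonical, phases, base]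
  · ext F
    constructor
    · rintro ⟨r, hr, rfl⟩
      exact ⟨_, ⟨r, hr, rfl⟩, rfl⟩
    · rintro ⟨_, ⟨r, hr, rfl⟩, rfl⟩
      exact ⟨r, hr, rfl⟩

lemma memAWith_iff {k n : ℕ} (hk : k ∈ ({1, 2, 3} : Finset ℕ)) {f : Fin (n + 1) → ℂ}
    {H : Matrix (Fin 2) (Fin 2) ℂ} :
    MemAWith k f H ↔ Hᵀ * H = 1 ∧ ∃ c : ℂ, c ≠ 0 ∧ ∃ ε ∈ phases k n,
      IsSum f c (H *ᵥ ![1, base k]) (c * ε) (H *ᵥ ![1, -base k]) := by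
  unfold MemAWith
  rw [canonical_eq hk]
  simp only [Set.exists_mem_image, transform_add_smul, transform_tensorPow, isSum_iff, smul_add,
    smul_smul]

lemma det₂_mulVec (H : Matrix (Fin 2) (Fin 2) ℂ) (u v : Fin 2 → ℂ) :
    det₂ (H *ᵥ u) (H *ᵥ v) = H.det * det₂ u v := by
  simp [det₂, mulVec, dotProduct, Fin.sum_univ_two, det_fin_two]
  ring

lemma base_ne_zero (k : ℕ) : base k ≠ 0 := by
  unfold base
  split
  · exact one_ne_zero
  · exact Complex.I_ne_zero
  · exact alpha_ne_zero

lemma phases_ne_zero {k n : ℕ} {ε : ℂ} (h : ε ∈ phases k n) : ε ≠ 0 := by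
  unfold phases at h
  split at h
  · obtain ⟨t, r, -, -, rfl⟩ := h
    exact pow_ne_zero _ alpha_ne_zero
  · rw [h]; exact one_ne_zero
  · obtain ⟨r, -, rfl⟩ := h
    exact pow_ne_zero _ Complex.I_ne_zero

/-- H is invertible, and (1, ±b) are independent because b ≠ 0. -/
lemma MemAWith.decomposes {k n : ℕ} (hk : k ∈ ({1, 2, 3} : Finset ℕ)) {f : Fin (n + 1) → ℂ}
    {H : Matrix (Fin 2) (Fin 2) ℂ} (h : MemAWith k f H) :
    ∃ c : ℂ, ∃ ε ∈ phases k n,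
      Decomposes f c (H *ᵥ ![1, base k]) (c * ε) (H *ᵥ ![1, -base k]) := by
  obtain ⟨hH, c, hc, ε, hε, hs⟩ := (memAWith_iff hk).mp h
  refine ⟨c, ε, hε, hs, hc, mul_ne_zero hc (phases_ne_zero hε), ?_⟩
  rw [det₂_mulVec]
  refine mul_ne_zero (fun h0 => ?_) ?_
  · have := congrArg det hH
    simp [h0] at this
  · have := base_ne_zero k
    simp only [det₂, cons_val_zero, cons_val_one]
    intro h0
    exact this (by linear_combination (-1 / 2 : ℂ) * h0)

/-! ### The bilinear form and the membership criterion -/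

/-- The bilinear (not hermitian) form on `ℂ²`. -/
def dot₂ (u v : Fin 2 → ℂ) : ℂ := u 0 * v 0 + u 1 * v 1

lemma dot₂_comm (u v : Fin 2 → ℂ) : dot₂ u v = dot₂ v u := by unfold dot₂; ring

lemma dot₂_smul (a b : ℂ) (u v : Fin 2 → ℂ) : dot₂ (a • u) (b • v) = a * b * dot₂ u v := by
  simp [dot₂]; ring

lemma dot₂_mulVec {H : Matrix (Fin 2) (Fin 2) ℂ} (hH : Hᵀ * H = 1) (u v : Fin 2 → ℂ) :
    dot₂ (H *ᵥ u) (H *ᵥ v) = dot₂ u v := by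
  have h00 := congrFun (congrFun hH 0) 0
  have h01 := congrFun (congrFun hH 0) 1
  have h11 := congrFun (congrFun hH 1) 1
  simp [mul_apply, Fin.sum_univ_two] at h00 h01 h11
  simp [dot₂, mulVec, dotProduct, Fin.sum_univ_two]
  linear_combination u 0 * v 0 * h00 + (u 0 * v 1 + u 1 * v 0) * h01 + u 1 * v 1 * h11

/-- Membership of `c₁ u^{⊗n} + c₂ v^{⊗n}` in `𝒜_k`, in terms of the inner products of `u`, `v` and
of the coefficients. -/
def Criterion (k n : ℕ) (c₁ : ℂ) (u : Fin 2 → ℂ) (c₂ : ℂ) (v : Fin 2 → ℂ) : Prop :=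
  match k with
  | 1 => dot₂ u u ≠ 0 ∧ dot₂ v v ≠ 0 ∧ dot₂ u v = 0 ∧
      ∃ e : ℂ, (e = 1 ∨ e = (-1) ^ n) ∧
        c₂ ^ 4 * dot₂ v v ^ (2 * n) = e * (c₁ ^ 4 * dot₂ u u ^ (2 * n))
  | 2 => dot₂ u u = 0 ∧ dot₂ v v = 0
  | _ => dot₂ u u ≠ 0 ∧ dot₂ v v ≠ 0 ∧ dot₂ u v ^ 2 = -(dot₂ u u * dot₂ v v) ∧
      c₂ ^ 4 * dot₂ v v ^ (2 * n) = c₁ ^ 4 * dot₂ u u ^ (2 * n)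

/-- Exchanging the vectors inverts the ratio of coefficients, and the sign e is its own inverse. -/
lemma Criterion.swap {k n : ℕ} {c₁ c₂ : ℂ} {u v : Fin 2 → ℂ} (h : Criterion k n c₁ u c₂ v) :
    Criterion k n c₂ v c₁ u := by
  unfold Criterion at h ⊢
  split at h
  · obtain ⟨hu, hv, huv, e, he, h⟩ := h
    refine ⟨hv, hu, by rwa [dot₂_comm], e, he, ?_⟩
    have h2 : e * e = 1 := by
      rcases he with rfl | rfl
      · simp
      · rw [← mul_pow]; simp
    rw [h, ← mul_assoc, h2, one_mul]
  · exact h.symm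
  · obtain ⟨hu, hv, huv, h⟩ := h
    exact ⟨hv, hu, by rw [dot₂_comm, huv]; ring, h.symm⟩

/-- The exponents 4 and 2n are balanced: moving a factor κ from the vector into the coefficient as
κ^n leaves c⁴(u·u)^{2n} unchanged. -/
lemma Criterion.of_smul {k n : ℕ} {d₁ d₂ κ κ' : ℂ} {u v : Fin 2 → ℂ}
    (hκ : κ ≠ 0) (hκ' : κ' ≠ 0) (h : Criterion k n d₁ (κ • u) d₂ (κ' • v)) :
    Criterion k n (d₁ * κ ^ n) u (d₂ * κ' ^ n) v := by
  unfold Criterion at h ⊢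
  simp only [dot₂_smul] at h
  split at h
  · obtain ⟨hu, hv, huv, e, he, h⟩ := h
    refine ⟨right_ne_zero_of_mul hu, right_ne_zero_of_mul hv, ?_, e, he, ?_⟩
    · simpa [hκ, hκ'] using huv
    · rw [mul_pow, mul_pow] at h
      linear_combination h
  · exact ⟨by simpa [hκ] using h.1, by simpa [hκ'] using h.2⟩
  · obtain ⟨hu, hv, huv, h⟩ := h
    refine ⟨right_ne_zero_of_mul hu, right_ne_zero_of_mul hv, ?_, ?_⟩
    · have : (κ * κ') ^ 2 ≠ 0 := pow_ne_zero _ (mul_ne_zero hκ hκ')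
      exact mul_left_cancel₀ this (by linear_combination huv)
    · rw [mul_pow, mul_pow] at h
      linear_combination h

/-- By uniqueness two decompositions differ by rescaling and order only, so the criterion is a
property of the signature. -/
lemma Criterion.transfer {k n : ℕ} (hn : 3 ≤ n) {f : Fin (n + 1) → ℂ}
    {c₁ c₂ d₁ d₂ : ℂ} {u v p q : Fin 2 → ℂ} (h : Decomposes f c₁ u c₂ v)
    (h' : Decomposes f d₁ p d₂ q) (hC : Criterion k n d₁ p d₂ q) : Criterion k n c₁ u c₂ v := by
  have hp := det₂_ne_zero_left h'.det_ne
  have hq := det₂_ne_zero_left h'.swap.det_ne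
  rcases h.unique hn h' with ⟨κ, κ', rfl, rfl, rfl, rfl⟩ | ⟨κ, κ', rfl, rfl, rfl, rfl⟩
  · exact hC.of_smul (left_ne_zero_of_smul hp) (left_ne_zero_of_smul hq)
  · exact (hC.of_smul (left_ne_zero_of_smul hp) (left_ne_zero_of_smul hq)).swap

/-- For (1, ±b) the norms are 1 + b² and the mixed product is 1 − b²: these are 2 and 0 for 𝒜₁, 0
and 2 for 𝒜₂, 1 + i and 1 − i for 𝒜₃, where (1 − i)² = −(1 + i)². Taking fourth powers removes the
choice of r and leaves (−1)^{tn} for 𝒜₁. -/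
lemma criterion_canonical {k n : ℕ} (hk : k ∈ ({1, 2, 3} : Finset ℕ)) {c ε : ℂ}
    (hε : ε ∈ phases k n) {H : Matrix (Fin 2) (Fin 2) ℂ} (hH : Hᵀ * H = 1) :
    Criterion k n c (H *ᵥ ![1, base k]) (c * ε) (H *ᵥ ![1, -base k]) := by
  unfold Criterion
  simp only [dot₂_mulVec hH]
  simp only [Finset.mem_insert, Finset.mem_singleton] at hk
  rcases hk with rfl | rfl | rfl
  · obtain ⟨t, r, ht, hr, rfl⟩ := hε
    refine ⟨by norm_num [dot₂, base], by norm_num [dot₂, base], by norm_num [dot₂, base],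
      (-1) ^ (t * n), ?_, ?_⟩
    · interval_cases t <;> simp
    · have : (alpha ^ (t * n + 2 * r)) ^ 4 = (-1) ^ (t * n) := by
        rw [← pow_mul, mul_comm, pow_mul, alpha_pow_four, pow_add, pow_mul (-1) 2]
        simp
      rw [mul_pow, this]
      norm_num [dot₂, base]
      ring
  · norm_num [dot₂, base]
  · obtain ⟨r, hr, rfl⟩ := hε
    have hI : (1 + Complex.I) ≠ 0 := by
      intro h; have := congrArg Complex.re h; norm_num at this
    have hb : alpha * alpha = Complex.I := by rw [← alpha_sq]; ring
    have h4 : (Complex.I ^ r) ^ 4 = 1 := by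
      rw [← pow_mul, mul_comm, pow_mul, Complex.I_pow_four, one_pow]
    refine ⟨?_, ?_, ?_, ?_⟩
    · simpa [dot₂, base, hb] using hI
    · simpa [dot₂, base, hb] using hI
    · simp [dot₂, base, hb]
      linear_combination 2 * Complex.I_sq
    · rw [mul_pow, h4]
      simp [dot₂]

lemma Decomposes.criterion_of_memA {k n : ℕ} (hn : 3 ≤ n) (hk : k ∈ ({1, 2, 3} : Finset ℕ))
    {f : Fin (n + 1) → ℂ} {c₁ c₂ : ℂ} {u v : Fin 2 → ℂ} (h : Decomposes f c₁ u c₂ v)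
    (hf : MemA k f) : Criterion k n c₁ u c₂ v := by
  obtain ⟨H, hH⟩ := hf
  obtain ⟨c, ε, hε, h'⟩ := hH.decomposes hk
  exact (criterion_canonical hk hε hH.1).transfer hn h h'

/-- Isotropy separates 𝒜₂ from the other two; between 𝒜₁ and 𝒜₃ the mixed product decides, being
zero in one and non-zero in the other. -/
lemma Criterion.eq {j k n : ℕ} (hj : j ∈ ({1, 2, 3} : Finset ℕ)) (hk : k ∈ ({1, 2, 3} : Finset ℕ))
    {c₁ c₂ : ℂ} {u v : Fin 2 → ℂ} (h : Criterion j n c₁ u c₂ v) (h' : Criterion k n c₁ u c₂ v) :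
    j = k := by
  simp only [Finset.mem_insert, Finset.mem_singleton] at hj hk
  have h13 : dot₂ u v = 0 → dot₂ u v ^ 2 = -(dot₂ u u * dot₂ v v) →
      dot₂ u u = 0 ∨ dot₂ v v = 0 := by
    intro h h'
    rw [h] at h'
    simpa using h'.symm
  rcases hj with rfl | rfl | rfl <;> rcases hk with rfl | rfl | rfl <;>
    simp only [Criterion] at h h' ⊢ <;> exfalso <;> tauto

/-- A signature belongs to at most one of the classes. -/
theorem eq_of_memA {n : ℕ} (hn : 3 ≤ n) {f : Fin (n + 1) → ℂ} {j k : ℕ}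
    (hj : j ∈ ({1, 2, 3} : Finset ℕ)) (hk : k ∈ ({1, 2, 3} : Finset ℕ))
    (h : MemA j f) (h' : MemA k f) : j = k := by
  obtain ⟨H, hH⟩ := h
  obtain ⟨c, ε, hε, hd⟩ := hH.decomposes hj
  exact (hd.criterion_of_memA hn hj ⟨H, hH⟩).eq hj hk (hd.criterion_of_memA hn hk h')

/-! ### Transformations -/

/-- The scale factors enter the coefficients as a^n and b^n; `hc` says that the ratio of the
rescaled coefficients is the admissible phase. -/
lemma memAWith_of_mulVec {k n : ℕ} (hk : k ∈ ({1, 2, 3} : Finset ℕ)) {f : Fin (n + 1) → ℂ}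
    {c₁ c₂ a b ε : ℂ} {u v : Fin 2 → ℂ} (h : Decomposes f c₁ u c₂ v)
    {H : Matrix (Fin 2) (Fin 2) ℂ} (hH : Hᵀ * H = 1) (ha : a ≠ 0) (hb : b ≠ 0)
    (hu : H *ᵥ ![1, base k] = a • u) (hv : H *ᵥ ![1, -base k] = b • v)
    (hε : ε ∈ phases k n) (hc : c₂ * a ^ n = ε * (c₁ * b ^ n)) : MemAWith k f H := by
  refine (memAWith_iff hk).mpr ⟨hH, c₁ / a ^ n, div_ne_zero h.left_ne (pow_ne_zero _ ha), ε, hε, ?_⟩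
  intro j
  have hs : ∀ x : ℂ, x ^ n = x ^ (n - j : ℕ) * x ^ (j : ℕ) := fun x => by
    rw [← pow_add]; congr 1; omega
  have hc2 : c₁ / a ^ n * ε = c₂ / b ^ n := by
    have := pow_ne_zero n ha
    have := pow_ne_zero n hb
    field_simp
    linear_combination -hc
  rw [h.isSum j, hc2, hu, hv]
  simp only [Pi.smul_apply, smul_eq_mul, mul_pow]
  rw [hs a, hs b]
  field_simp

lemma transpose_mul_self_eq_one {a b c d : ℂ} (h1 : a * a + c * c = 1) (h2 : a * b + c * d = 0)
    (h3 : b * b + d * d = 1) : (!![a, b; c, d])ᵀ * !![a, b; c, d] = 1 := by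
  ext i j
  fin_cases i <;> fin_cases j <;> simp [mul_apply, Fin.sum_univ_two]
  · exact h1
  · exact h2
  · linear_combination h2
  · exact h3

lemma exists_I_pow_eq {x : ℂ} (h : x ^ 4 = 1) : ∃ r : ℕ, r ≤ 3 ∧ x = Complex.I ^ r := by
  have : (x - 1) * (x + 1) * (x - Complex.I) * (x + Complex.I) = 0 := by
    linear_combination h + (1 - x ^ 2) * Complex.I_sq
  simp only [mul_eq_zero] at this
  rcases this with ((h | h) | h) | h
  · exact ⟨0, by norm_num, by linear_combination h⟩
  · exact ⟨2, by norm_num, by linear_combination h - Complex.I_sq⟩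
  · exact ⟨1, by norm_num, by linear_combination h⟩
  · exact ⟨3, by norm_num, by rw [Complex.I_pow_three]; linear_combination h⟩

/-- After normalizing u and v by s and t the coefficients are c₁s^n and c₂t^n. The fourth power of
their ratio involves only s² and t², so any choice of square roots serves. -/
lemma pow_four_eq {n : ℕ} {c₁ c₂ s t U V e : ℂ} (hc : c₁ ≠ 0) (hs : s ^ 2 = U) (ht : t ^ 2 = V)
    (hU : U ≠ 0)
    (h : c₂ ^ 4 * V ^ (2 * n) = e * (c₁ ^ 4 * U ^ (2 * n))) :
    (c₂ * t ^ n / (c₁ * s ^ n)) ^ 4 = e := by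
  subst hs ht
  have hs : s ≠ 0 := fun h => hU (by simp [h])
  rw [div_pow, div_eq_iff (pow_ne_zero _ (mul_ne_zero hc (pow_ne_zero _ hs)))]
  rw [← pow_mul, ← pow_mul] at h
  rw [mul_pow, mul_pow, ← pow_mul, ← pow_mul]
  convert h using 3 <;> ring

/-- The vectors x = u/s and y = v/t are orthonormal for the bilinear form. The columns (x ± y)/τ are
obtained by a Hadamard rotation, so H maps (1, ±1) to τx and τy. -/
lemma memAWith_one {n : ℕ} {f : Fin (n + 1) → ℂ} {c₁ c₂ s t τ : ℂ} {u v : Fin 2 → ℂ}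
    (h : Decomposes f c₁ u c₂ v) (hC : Criterion 1 n c₁ u c₂ v)
    (hs : s ^ 2 = dot₂ u u) (ht : t ^ 2 = dot₂ v v) (hτ : τ ^ 2 = 2) :
    MemAWith 1 f !![(u 0 / s + v 0 / t) / τ, (u 0 / s - v 0 / t) / τ;
      (u 1 / s + v 1 / t) / τ, (u 1 / s - v 1 / t) / τ] := by
  obtain ⟨hu, hv, huv, e, he, hC⟩ := hC
  have hρ := pow_four_eq h.left_ne hs ht hu hC
  have hs0 : s ≠ 0 := fun h => hu (by rw [← hs, h]; ring)
  have ht0 : t ≠ 0 := fun h => hv (by rw [← ht, h]; ring)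
  have hτ0 : τ ≠ 0 := fun h => by rw [h] at hτ; norm_num at hτ
  have hε : c₂ * t ^ n / (c₁ * s ^ n) ∈ phases 1 n := by
    rcases he with rfl | rfl
    · obtain ⟨r, hr, h⟩ := exists_I_pow_eq hρ
      exact ⟨0, r, by norm_num, hr, by rw [h, ← alpha_sq, ← pow_mul]; ring⟩
    -- The sign (−1)^n corresponds to t = 1 in the canonical form: dividing by α^n leaves a fourth
    -- root of unity.
    · have : (c₂ * t ^ n / (c₁ * s ^ n) / alpha ^ n) ^ 4 = 1 := by
        rw [div_pow, hρ, ← pow_mul, mul_comm n, pow_mul, alpha_pow_four, div_self]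
        exact pow_ne_zero _ (by norm_num)
      obtain ⟨r, hr, h⟩ := exists_I_pow_eq this
      refine ⟨1, r, le_rfl, hr, ?_⟩
      rw [div_eq_iff (pow_ne_zero _ alpha_ne_zero)] at h
      rw [h, ← alpha_sq, ← pow_mul]
      ring
  unfold dot₂ at hs ht huv
  refine memAWith_of_mulVec (a := τ / s) (b := τ / t) (by simp) h ?_ (div_ne_zero hτ0 hs0)
    (div_ne_zero hτ0 ht0) ?_ ?_ hε ?_
  · apply transpose_mul_self_eq_one
    · field_simp
      linear_combination (-t ^ 2) * hs - s ^ 2 * ht + 2 * s * t * huv - s ^ 2 * t ^ 2 * hτ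
    · field_simp
      linear_combination (-t ^ 2) * hs + s ^ 2 * ht
    · field_simp
      linear_combination (-t ^ 2) * hs - s ^ 2 * ht - 2 * s * t * huv - s ^ 2 * t ^ 2 * hτ
  · ext i
    fin_cases i <;> simp [base, mulVec, dotProduct, Fin.sum_univ_two] <;> field_simp <;>
      rw [hτ] <;> ring
  · ext i
    fin_cases i <;> simp [base, mulVec, dotProduct, Fin.sum_univ_two] <;> field_simp <;>
      rw [hτ] <;> ring
  · have := h.left_ne
    simp only [div_pow]
    field_simp

/-- Independent isotropic vectors with first coordinate 1 are (1, i) and (1, −i) in some order. H is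
the complex rotation with these eigenvectors and eigenvalues l, 1/l; the condition on l^{2n} makes
the two coefficients equal. -/
lemma memAWith_two {n : ℕ} (hn : n ≠ 0) {f : Fin (n + 1) → ℂ} {c₁ c₂ l : ℂ} {u v : Fin 2 → ℂ}
    (h : Decomposes f c₁ u c₂ v) (hC : Criterion 2 n c₁ u c₂ v) (hu : u 0 = 1) (hv : v 0 = 1)
    (hl : l ^ (2 * n) = c₁ / c₂) :
    MemAWith 2 f !![(l + 1 / l) / 2, (l - 1 / l) / (2 * u 1);
      -((l - 1 / l) / (2 * u 1)), (l + 1 / l) / 2] := by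
  obtain ⟨hC1, hC2⟩ := hC
  have hdet := h.det_ne
  simp only [dot₂, det₂, hu, hv] at hC1 hC2 hdet
  have hl0 : l ≠ 0 := by
    rintro rfl
    rw [zero_pow (by omega)] at hl
    exact div_ne_zero h.left_ne h.right_ne hl.symm
  have hu0 : u 1 ≠ 0 := fun h => by simp [h] at hC1
  have hvu : v 1 = -u 1 := by
    have : (v 1 - u 1) * (v 1 + u 1) = 0 := by linear_combination hC2 - hC1
    refine eq_neg_of_add_eq_zero_left ((mul_eq_zero.mp this).resolve_left fun h => hdet ?_)
    linear_combination h
  have hln : c₂ * l ^ n * l ^ n = c₁ := by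
    have := h.right_ne
    rw [mul_assoc, ← pow_add, ← two_mul, hl]
    field_simp
  have hsq : u 1 ^ 2 = -1 := by linear_combination hC1
  have hHu : !![(l + 1 / l) / 2, (l - 1 / l) / (2 * u 1);
      -((l - 1 / l) / (2 * u 1)), (l + 1 / l) / 2] *ᵥ u = l • u := by
    ext i
    fin_cases i <;> simp [mulVec, dotProduct, Fin.sum_univ_two, hu] <;> field_simp
    · ring
    · rw [hsq]; ring
  have hHv : !![(l + 1 / l) / 2, (l - 1 / l) / (2 * u 1);
      -((l - 1 / l) / (2 * u 1)), (l + 1 / l) / 2] *ᵥ v = (1 / l) • v := by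
    ext i
    fin_cases i <;> simp [mulVec, dotProduct, Fin.sum_univ_two, hv, hvu] <;> field_simp
    · ring
    · rw [hsq]; ring
  have hH : (!![(l + 1 / l) / 2, (l - 1 / l) / (2 * u 1);
      -((l - 1 / l) / (2 * u 1)), (l + 1 / l) / 2])ᵀ * !![(l + 1 / l) / 2, (l - 1 / l) / (2 * u 1);
      -((l - 1 / l) / (2 * u 1)), (l + 1 / l) / 2] = 1 := by
    apply transpose_mul_self_eq_one
    · field_simp; rw [hsq]; ring
    · ring
    · field_simp; rw [hsq]; ring
  have hu1 : (u 1 - Complex.I) * (u 1 + Complex.I) = 0 := by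
    linear_combination hsq - Complex.I_sq
  have hvec : ∀ w : Fin 2 → ℂ, w 0 = 1 → ![1, w 1] = w := fun w hw => by
    ext i; fin_cases i <;> simp [hw]
  -- If u = (1, −i), the second canonical vector is u, and the decomposition is used in swapped
  -- order.
  rcases mul_eq_zero.mp hu1 with h1 | h1
  · have e1 : ![1, base 2] = u := by
      rw [← hvec u hu, show u 1 = Complex.I by linear_combination h1]; rfl
    have e2 : ![1, -base 2] = v := by
      rw [← hvec v hv, hvu, show u 1 = Complex.I by linear_combination h1]; rfl
    refine memAWith_of_mulVec (by simp) h hH hl0 (one_div_ne_zero hl0) (e1 ▸ hHu) (e2 ▸ hHv)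
      rfl ?_
    rw [← hln, div_pow, one_pow]
    field_simp
  · have e1 : ![1, base 2] = v := by
      rw [← hvec v hv, hvu, show u 1 = -Complex.I by linear_combination h1, neg_neg]; rfl
    have e2 : ![1, -base 2] = u := by
      rw [← hvec u hu, show u 1 = -Complex.I by linear_combination h1]; rfl
    refine memAWith_of_mulVec (by simp) h.swap hH (one_div_ne_zero hl0) hl0 (e1 ▸ hHv) (e2 ▸ hHu)
      rfl ?_
    rw [← hln, div_pow, one_pow]
    field_simp

/-- The sign w = ±1 is chosen so that x = u/s and y = wv/t satisfy x·x = y·y = 1 and x·y = −i. These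
are the products of (1, ±α)/η, since (1 − i)/(1 + i) = −i, so the linear map sending (1, ±α) to ηx,
ηy is orthogonal; its columns are η(x + y)/2 and η(x − y)/(2α). -/
lemma memAWith_three {n : ℕ} {f : Fin (n + 1) → ℂ} {c₁ c₂ s t w η : ℂ} {u v : Fin 2 → ℂ}
    (h : Decomposes f c₁ u c₂ v) (hC : Criterion 3 n c₁ u c₂ v)
    (hs : s ^ 2 = dot₂ u u) (ht : t ^ 2 = dot₂ v v) (hη : η ^ 2 = 1 + Complex.I)
    (hw : w = Complex.I * dot₂ u v / (s * t)) :
    MemAWith 3 f !![η * (u 0 / s + w * (v 0 / t)) / 2, η * (u 0 / s - w * (v 0 / t)) / (2 * alpha);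
      η * (u 1 / s + w * (v 1 / t)) / 2, η * (u 1 / s - w * (v 1 / t)) / (2 * alpha)] := by
  obtain ⟨hu, hv, huv, hC⟩ := hC
  have hρ := pow_four_eq (e := 1) h.left_ne hs ht hu (by rw [hC, one_mul])
  have hs0 : s ≠ 0 := fun h => hu (by rw [← hs, h]; ring)
  have ht0 : t ≠ 0 := fun h => hv (by rw [← ht, h]; ring)
  have hα := alpha_ne_zero
  have hη0 : η ≠ 0 := by
    rintro rfl
    have := congrArg Complex.re hη
    norm_num at this
  have hw2 : w ^ 2 = 1 := by
    rw [hw, div_pow, mul_pow, mul_pow, huv, hs, ht, Complex.I_sq]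
    field_simp
  have hw0 : w ≠ 0 := by rintro rfl; norm_num at hw2
  have hε : c₂ * t ^ n / (c₁ * s ^ n) / w ^ n ∈ phases 3 n := by
    refine exists_I_pow_eq ?_
    rw [div_pow, hρ, ← pow_mul, mul_comm n, pow_mul, show w ^ 4 = (w ^ 2) ^ 2 by ring, hw2]
    simp
  have hXX : u 0 / s * (u 0 / s) + u 1 / s * (u 1 / s) = 1 := by
    field_simp; rw [hs]; unfold dot₂; ring
  have hYY : w * (v 0 / t) * (w * (v 0 / t)) + w * (v 1 / t) * (w * (v 1 / t)) = 1 := by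
    have : v 0 / t * (v 0 / t) + v 1 / t * (v 1 / t) = 1 := by
      field_simp; rw [ht]; unfold dot₂; ring
    linear_combination w ^ 2 * this + hw2
  have hXY : u 0 / s * (w * (v 0 / t)) + u 1 / s * (w * (v 1 / t)) = -Complex.I := by
    have : dot₂ u v / (s * t) = u 0 / s * (v 0 / t) + u 1 / s * (v 1 / t) := by
      unfold dot₂; field_simp
    rw [mul_div_assoc, this] at hw
    linear_combination (Complex.I * w) * hw - Complex.I * hw2 +
      w * (u 0 / s * (v 0 / t) + u 1 / s * (v 1 / t)) * Complex.I_sq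
  have hα2 := alpha_sq
  refine memAWith_of_mulVec (a := η / s) (b := η * w / t) (by simp) h ?_ (div_ne_zero hη0 hs0)
    (div_ne_zero (mul_ne_zero hη0 hw0) ht0) ?_ ?_ hε ?_
  · generalize u 0 / s = X0 at *
    generalize u 1 / s = X1 at *
    generalize w * (v 0 / t) = Y0 at *
    generalize w * (v 1 / t) = Y1 at *
    apply transpose_mul_self_eq_one
    · linear_combination (η ^ 2 / 4) * (hXX + hYY + 2 * hXY) + (1 - Complex.I) / 2 * hη -
        Complex.I_sq / 2
    · linear_combination (η ^ 2 / (4 * alpha)) * (hXX - hYY)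
    · have : η * (X0 - Y0) / (2 * alpha) * (η * (X0 - Y0) / (2 * alpha)) +
          η * (X1 - Y1) / (2 * alpha) * (η * (X1 - Y1) / (2 * alpha)) =
          η ^ 2 * ((X0 - Y0) ^ 2 + (X1 - Y1) ^ 2) / (4 * alpha ^ 2) := by
        field_simp; ring
      rw [this, hα2, hη, div_eq_one_iff_eq (mul_ne_zero (by norm_num) Complex.I_ne_zero)]
      linear_combination (1 + Complex.I) * (hXX + hYY - 2 * hXY) + 2 * Complex.I_sq
  · ext i
    fin_cases i <;> simp [base, mulVec, dotProduct, Fin.sum_univ_two] <;> field_simp <;> ring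
  · ext i
    fin_cases i <;> simp [base, mulVec, dotProduct, Fin.sum_univ_two] <;> field_simp <;> ring
  · have := h.left_ne
    simp only [div_pow, mul_pow]
    field_simp

end

/-! ### Computing a decomposition -/

lemma IsSum.of_affine {n : ℕ} {f : Fin (n + 1) → ℂ} {c₁ c₂ : ℂ} {u v : Fin 2 → ℂ}
    (hu : u 0 = 1) (hv : v 0 = 1)
    (h : ∀ j : Fin (n + 1), f j = c₁ * u 1 ^ (j : ℕ) + c₂ * v 1 ^ (j : ℕ)) :
    IsSum f c₁ u c₂ v := fun j => by simp [h j, hu, hv]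

/-- The tensor power of (0,1) is supported on the all-ones input, so only the last entry sees it and
determines its coefficient. -/
lemma IsSum.of_infinite {n : ℕ} {f : Fin (n + 1) → ℂ} {c₁ c₂ : ℂ} {u v : Fin 2 → ℂ}
    (hu : u 0 = 0) (hu' : u 1 = 1) (hv : v 0 = 1)
    (h : ∀ j : Fin (n + 1), (j : ℕ) < n → f j = c₂ * v 1 ^ (j : ℕ))
    (hc : c₁ = f (Fin.last n) - c₂ * v 1 ^ n) : IsSum f c₁ u c₂ v := by
  intro j
  by_cases hj : (j : ℕ) < n
  · simp [h j hj, hu, hv, zero_pow (Nat.sub_ne_zero_of_lt hj)]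
  · have : j = Fin.last n := Fin.ext (by have := j.2; simp; omega)
    subst this
    simp [hu', hv, hc]

/-- The matrix with rows (f₀, f₁), (f₁, f₂) is the sum of c₁u₀^{n−2}uuᵀ and c₂v₀^{n−2}vvᵀ. As n − 2
> 0, its determinant detects a vector with first coordinate zero. -/
lemma Decomposes.hankel {n : ℕ} {f : ℕ → ℂ} {c₁ c₂ : ℂ} {u v : Fin 2 → ℂ} (hn : 3 ≤ n)
    (h : Decomposes (fun j : Fin (n + 1) => f j) c₁ u c₂ v) :
    f 0 * f 2 - f 1 ^ 2 = c₁ * c₂ * (u 0 * v 0) ^ (n - 2) * det₂ u v ^ 2 := by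
  have h0 := h.isSum ⟨0, by omega⟩
  have h1 := h.isSum ⟨1, by omega⟩
  have h2 := h.isSum ⟨2, by omega⟩
  have e0 : n = n - 2 + 2 := by omega
  have e1 : n - 1 = n - 2 + 1 := by omega
  simp only [Nat.sub_zero] at h0 h1 h2
  rw [e1] at h1
  rw [show ∀ x : ℂ, x ^ n = x ^ (n - 2) * x ^ 2 from fun x => by
    rw [← pow_add]; congr 1,
    show ∀ x : ℂ, x ^ n = x ^ (n - 2) * x ^ 2 from fun x => by
    rw [← pow_add]; congr 1] at h0
  rw [h0, h1, h2, det₂, mul_pow]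
  ring

lemma Decomposes.exists_affine {n : ℕ} {f : ℕ → ℂ} {c₁ c₂ : ℂ} {u v : Fin 2 → ℂ} (hn : 3 ≤ n)
    (h : Decomposes (fun j : Fin (n + 1) => f j) c₁ u c₂ v) (hΔ : f 0 * f 2 - f 1 ^ 2 ≠ 0) :
    ∃ d₁ d₂ x y : ℂ, d₁ ≠ 0 ∧ d₂ ≠ 0 ∧ x ≠ y ∧ ∀ j ≤ n, f j = d₁ * x ^ j + d₂ * y ^ j := by
  rw [h.hankel hn] at hΔ
  have h1 : u 0 ≠ 0 := fun h0 => hΔ (by simp [h0, zero_pow (show n - 2 ≠ 0 by omega)])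
  have h2 : v 0 ≠ 0 := fun h0 => hΔ (by simp [h0, zero_pow (show n - 2 ≠ 0 by omega)])
  refine ⟨c₁ * u 0 ^ n, c₂ * v 0 ^ n, u 1 / u 0, v 1 / v 0, mul_ne_zero h.left_ne (pow_ne_zero _ h1),
    mul_ne_zero h.right_ne (pow_ne_zero _ h2), fun he => h.det_ne ?_, fun j hj => ?_⟩
  · rw [div_eq_div_iff h1 h2] at he
    unfold det₂
    linear_combination -he
  · have hs : ∀ x : ℂ, x ^ n = x ^ (n - j : ℕ) * x ^ (j : ℕ) := fun x => by
      rw [← pow_add]; congr 1; omega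
    have := h.isSum ⟨j, by omega⟩
    simp only at this
    rw [this, hs, hs, div_pow, div_pow]
    field_simp

/-- The quadratic formula for a decomposition with two finite slopes. -/
lemma Decomposes.eq_of_hankel_ne_zero {n : ℕ} {f : ℕ → ℂ} {c₁ c₂ : ℂ} {u v : Fin 2 → ℂ}
    (hn : 3 ≤ n) (h : Decomposes (fun j : Fin (n + 1) => f j) c₁ u c₂ v)
    {a b c δ μ ν d : ℂ} (hc : c = f 0 * f 2 - f 1 ^ 2) (hc0 : c ≠ 0) (hb : b = f 1 * f 2 - f 0 * f 3)
    (ha : a = f 1 * f 3 - f 2 ^ 2) (hδ : δ ^ 2 = b ^ 2 - 4 * (a * c))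
    (hμ : μ = (-b + δ) / (2 * c)) (hν : ν = (-b - δ) / (2 * c))
    (hd : d = (f 1 - f 0 * ν) / (μ - ν)) : ∀ j ≤ n, f j = d * μ ^ j + (f 0 - d) * ν ^ j := by
  obtain ⟨d₁, d₂, x, y, h1, h2, hxy, hf⟩ := h.exists_affine hn (hc ▸ hc0)
  have e0 := hf 0 (by omega)
  have e1 := hf 1 (by omega)
  have e2 := hf 2 (by omega)
  have e3 := hf 3 (by omega)
  -- The slopes x, y are thus the roots of cX² + bX + a.
  have hb' : b = -c * (x + y) := by rw [hb, hc, e0, e1, e2, e3]; ring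
  have ha' : a = c * (x * y) := by rw [ha, hc, e0, e1, e2, e3]; ring
  have hδ' : (δ - c * (x - y)) * (δ + c * (x - y)) = 0 := by
    rw [hb', ha'] at hδ
    linear_combination hδ
  have hxy' : x - y ≠ 0 := sub_ne_zero.mpr hxy
  have hyx' : y - x ≠ 0 := sub_ne_zero.mpr hxy.symm
  -- The sign of the square root only decides which slope is called μ.
  rcases mul_eq_zero.mp hδ' with h' | h'
  · have hμ' : μ = x := by
      rw [hμ, sub_eq_zero.mp h', hb']; field_simp; ring
    have hν' : ν = y := by
      rw [hν, sub_eq_zero.mp h', hb']; field_simp; ring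
    have hd' : d = d₁ := by
      rw [hd, hμ', hν', e0, e1]; field_simp; ring
    intro j hj
    rw [hμ', hν', hd', e0, hf j hj]; ring
  · have hμ' : μ = y := by
      rw [hμ, eq_neg_of_add_eq_zero_left h', hb']; field_simp; ring
    have hν' : ν = x := by
      rw [hν, eq_neg_of_add_eq_zero_left h', hb']; field_simp; ring
    have hd' : d = d₂ := by
      rw [hd, hμ', hν', e0, e1]; field_simp; ring
    intro j hj
    rw [hμ', hν', hd', e0, hf j hj]; ring

/-- Before the last entry only v contributes, so the entries are geometric with ratio v₁/v₀ and
non-zero first term. -/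
lemma Decomposes.eq_of_left_eq_zero {n : ℕ} {f : ℕ → ℂ} {c₁ c₂ : ℂ} {u v : Fin 2 → ℂ} (hn : 3 ≤ n)
    (h : Decomposes (fun j : Fin (n + 1) => f j) c₁ u c₂ v) (hu : u 0 = 0) :
    ∀ j < n, f j = f 0 * (f 1 / f 0) ^ j := by
  have hv : v 0 ≠ 0 := fun hv => h.det_ne (by simp [det₂, hu, hv])
  have key : ∀ j < n, f j = c₂ * (v 0 ^ (n - j) * v 1 ^ j) := fun j hj => by
    have := h.isSum ⟨j, by omega⟩
    simpa [hu, zero_pow (Nat.sub_ne_zero_of_lt hj)] using this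
  have := h.right_ne
  intro j hj
  have hs : v 0 ^ n = v 0 ^ (n - j) * v 0 ^ j := by rw [← pow_add]; congr 1; omega
  have e1 : v 0 ^ n = v 0 ^ (n - 1) * v 0 := by rw [← pow_succ]; congr 1; omega
  have hr : f 1 / f 0 = v 1 / v 0 := by
    rw [key 0 (by omega), key 1 (by omega), Nat.sub_zero, e1]
    field_simp
  rw [hr, key j hj, key 0 (by omega), Nat.sub_zero, hs, div_pow]
  field_simp

lemma Decomposes.eq_of_hankel_eq_zero {n : ℕ} {f : ℕ → ℂ} {c₁ c₂ : ℂ} {u v : Fin 2 → ℂ}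
    (hn : 3 ≤ n) (h : Decomposes (fun j : Fin (n + 1) => f j) c₁ u c₂ v)
    (hΔ : f 0 * f 2 - f 1 ^ 2 = 0) : ∀ j < n, f j = f 0 * (f 1 / f 0) ^ j := by
  rw [h.hankel hn] at hΔ
  simp only [mul_eq_zero, pow_eq_zero_iff', h.left_ne, h.right_ne, h.det_ne, false_or, or_false,
    ne_eq, false_and] at hΔ
  rcases hΔ.1 with hu | hv
  · exact h.eq_of_left_eq_zero hn hu
  · exact h.swap.eq_of_left_eq_zero hn hv

section

open Polynomial

/-! ### Bit sizes of algebraic numbers -/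

/-- The number `z` is a root of a nonzero integer polynomial of bit length at most `b`. -/
def BitBound (b : ℕ) (z : ℂ) : Prop :=
  ∃ p : ℤ[X], p ≠ 0 ∧ aeval z p = 0 ∧ polyBits p ≤ b

lemma BitBound.mono {a b : ℕ} {z : ℂ} (h : BitBound a z) (hab : a ≤ b) : BitBound b z :=
  let ⟨p, hp, hz, hb⟩ := h
  ⟨p, hp, hz, hb.trans hab⟩

lemma BitBound.bitSize_le {b : ℕ} {z : ℂ} (h : BitBound b z) : bitSize z ≤ b :=
  let ⟨p, hp, hz, hb⟩ := h
  le_trans (Nat.sInf_le (show polyBits p ∈ {b : ℕ | ∃ p : ℤ[X], p ≠ 0 ∧ aeval z p = 0 ∧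
    polyBits p = b} from ⟨p, hp, hz, rfl⟩)) hb

/-- Clearing denominators gives an integer polynomial, so the infimum runs over a non-empty set and
is attained. -/
lemma bitBound_bitSize {z : ℂ} (h : IsAlgebraic ℚ z) : BitBound (bitSize z) z := by
  obtain ⟨p, hp, hz⟩ := (IsFractionRing.isAlgebraic_iff ℤ ℚ ℂ).mpr h
  obtain ⟨q, hq, hqz, hb⟩ := Nat.sInf_mem (s := {b : ℕ | ∃ p : ℤ[X], p ≠ 0 ∧ aeval z p = 0 ∧
    polyBits p = b}) ⟨_, p, hp, hz, rfl⟩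
  exact ⟨q, hq, hqz, hb.le⟩

lemma polyBits_le {p : ℤ[X]} {d e : ℕ} (hd : p.natDegree ≤ d)
    (he : ∀ i, (p.coeff i).natAbs < 2 ^ e) : polyBits p ≤ (d + 1) * (1 + e) := by
  calc polyBits p ≤ ∑ i ∈ Finset.range (p.natDegree + 1), (1 + e) :=
        Finset.sum_le_sum fun i _ => by have := Nat.size_le.mpr (he i); omega
    _ = (p.natDegree + 1) * (1 + e) := by simp
    _ ≤ _ := by gcongr

lemma natDegree_lt_polyBits (p : ℤ[X]) : p.natDegree < polyBits p := by
  have : ∑ i ∈ Finset.range (p.natDegree + 1), 1 ≤ polyBits p :=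
    Finset.sum_le_sum fun i _ => Nat.le_add_right _ _
  simpa using this

lemma natAbs_coeff_lt_two_pow (p : ℤ[X]) (i : ℕ) : (p.coeff i).natAbs < 2 ^ polyBits p := by
  by_cases hi : i < p.natDegree + 1
  · refine Nat.size_le.mp ?_
    have := Finset.single_le_sum (f := fun i => 1 + Nat.size (p.coeff i).natAbs)
      (fun _ _ => Nat.zero_le _) (Finset.mem_range.mpr hi)
    unfold polyBits
    omega
  · rw [coeff_eq_zero_of_natDegree_lt (by omega)]
    simp

/-- The coefficients of an integer polynomial are bounded by those of a polynomial over `ℕ`. -/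
def Dominated (p : ℤ[X]) (g : ℕ[X]) : Prop := ∀ i, (p.coeff i).natAbs ≤ g.coeff i

lemma Dominated.mul {p q : ℤ[X]} {g h : ℕ[X]} (hp : Dominated p g) (hq : Dominated q h) :
    Dominated (p * q) (g * h) := fun i => by
  rw [coeff_mul, coeff_mul]
  refine (Int.natAbs_sum_le _ _).trans (Finset.sum_le_sum fun x _ => ?_)
  rw [Int.natAbs_mul]
  exact Nat.mul_le_mul (hp _) (hq _)

lemma Dominated.sum {ι : Type*} {s : Finset ι} {p : ι → ℤ[X]} {g : ι → ℕ[X]}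
    (h : ∀ i ∈ s, Dominated (p i) (g i)) : Dominated (∑ i ∈ s, p i) (∑ i ∈ s, g i) := fun j => by
  rw [finsetSum_coeff, finsetSum_coeff]
  exact (Int.natAbs_sum_le _ _).trans (Finset.sum_le_sum fun i hi => h i hi j)

lemma Dominated.prod {ι : Type*} {s : Finset ι} {p : ι → ℤ[X]} {g : ι → ℕ[X]}
    (h : ∀ i ∈ s, Dominated (p i) (g i)) : Dominated (∏ i ∈ s, p i) (∏ i ∈ s, g i) := by
  classical
  induction s using Finset.induction_on with
  | empty =>
    intro i
    simp only [Finset.prod_empty, coeff_one]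
    split <;> simp
  | insert a s ha ih =>
    rw [Finset.prod_insert ha, Finset.prod_insert ha]
    exact (h a (Finset.mem_insert_self _ _)).mul
      (ih fun i hi => h i (Finset.mem_insert_of_mem hi))

lemma Dominated.units_smul {p : ℤ[X]} {g : ℕ[X]} (h : Dominated p g) (u : ℤˣ) :
    Dominated (u • p) g := by
  rcases Int.units_eq_one_or u with rfl | rfl
  · simpa using h
  · intro i
    simpa using h i

lemma coeff_le_eval_one (g : ℕ[X]) (i : ℕ) : g.coeff i ≤ g.eval 1 := by
  by_cases hi : i < g.natDegree + 1
  · rw [eval_eq_sum_range]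
    simp only [one_pow, mul_one]
    exact Finset.single_le_sum (f := fun i => g.coeff i) (fun _ _ => Nat.zero_le _)
      (Finset.mem_range.mpr hi)
  · rw [coeff_eq_zero_of_natDegree_lt (by omega)]
    exact Nat.zero_le _

/-! ### Algebraic numbers as eigenvalues of integer matrices -/

/-- The number `z` is an eigenvalue of a rational matrix of order at most `D` whose entries have a
common denominator and numerators of absolute value at most `2 ^ m`. -/
def IsEigen (D m : ℕ) (z : ℂ) : Prop :=
  ∃ (ι : Type) (_ : Fintype ι) (_ : DecidableEq ι) (A : Matrix ι ι ℤ) (l : ℤ) (v : ι → ℂ),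
    Fintype.card ι ≤ D ∧ l ≠ 0 ∧ l.natAbs ≤ 2 ^ m ∧ (∀ i j, (A i j).natAbs ≤ 2 ^ m) ∧ v ≠ 0 ∧
    ∀ i, ∑ j, (A i j : ℂ) * v j = l * z * v i

/-- The companion matrix, multiplied by the leading coefficient to clear denominators, has
eigenvector (1, z, z², …). -/
lemma BitBound.isEigen {b : ℕ} {z : ℂ} (h : BitBound b z) : IsEigen b b z := by
  obtain ⟨p, hp, hz, hb⟩ := h
  have hpow : 2 ^ polyBits p ≤ 2 ^ b := Nat.pow_le_pow_right (by norm_num) hb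
  have hcoeff : ∀ i, (p.coeff i).natAbs ≤ 2 ^ b := fun i =>
    (natAbs_coeff_lt_two_pow p i).le.trans hpow
  -- A non-zero constant has no root; positive degree makes the index type inhabited and the
  -- eigenvector non-zero.
  have hd : p.natDegree ≠ 0 := by
    intro hd
    rw [eq_C_of_natDegree_eq_zero hd] at hz hp
    simp at hz
    exact hp (by simp [hz])
  have hsum : ∑ j ∈ Finset.range p.natDegree, (p.coeff j : ℂ) * z ^ j =
      -(p.leadingCoeff * z ^ p.natDegree) := by
    rw [aeval_eq_sum_range, Finset.sum_range_succ] at hz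
    simp only [zsmul_eq_mul] at hz
    rw [leadingCoeff]
    linear_combination hz
  refine ⟨Fin p.natDegree, inferInstance, inferInstance,
    fun i j => if (i : ℕ) + 1 < p.natDegree then (if (j : ℕ) = i + 1 then p.leadingCoeff else 0)
      else -p.coeff j, p.leadingCoeff, fun i => z ^ (i : ℕ), ?_, ?_, ?_, ?_, ?_, ?_⟩
  · simpa using (natDegree_lt_polyBits p).le.trans hb
  · simpa using hp
  · exact hcoeff _
  · intro i j
    dsimp only
    split_ifs
    · exact hcoeff _
    · simp
    · simpa using hcoeff _
  · intro h0
    have := congrFun h0 ⟨0, Nat.pos_of_ne_zero hd⟩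
    simp at this
  · intro i
    by_cases hi : (i : ℕ) + 1 < p.natDegree
    · simp only [hi, if_true]
      rw [Finset.sum_eq_single ⟨i + 1, hi⟩]
      · simp; ring
      · intro j _ hj
        rw [if_neg (fun h => hj (Fin.ext h))]
        simp
      · simp
    · have hi' : p.natDegree = i + 1 := by omega
      simp only [hi, if_false, Int.cast_neg, neg_mul, Finset.sum_neg_distrib]
      rw [Fin.sum_univ_eq_sum_range (fun j => (p.coeff j : ℂ) * z ^ j), hsum, neg_neg, mul_assoc,
        ← pow_succ', ← hi']

/-- The polynomial det(lX − A) vanishes at z and has top coefficient a power of l. The Leibniz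
formula bounds its coefficients by at most D! products of D entries, each dominated by 2^m X + 2^m.
-/
lemma IsEigen.bitBound {D m : ℕ} {z : ℂ} (h : IsEigen D m z) :
    BitBound ((D + 1) * (2 + D * (1 + D + m))) z := by
  obtain ⟨ι, _, _, A, l, v, hD, hl, hlm, hA, hv, heq⟩ := h
  set M : Matrix ι ι ℤ[X] := (X : ℤ[X]) • (Matrix.diagonal fun _ : ι => l).map C + (-A).map C with hM
  have hdeg : M.det.natDegree ≤ Fintype.card ι := natDegree_det_X_add_C_le _ _
  have hne : M.det ≠ 0 := by
    intro h0
    have := coeff_det_X_add_C_card (Matrix.diagonal fun _ : ι => l) (-A)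
    rw [← hM, h0] at this
    simp only [coeff_zero, Matrix.det_diagonal, Finset.prod_const] at this
    exact pow_ne_zero _ hl this.symm
  have hroot : aeval z M.det = 0 := by
    rw [AlgHom.map_det]
    refine Matrix.exists_mulVec_eq_zero_iff.mp ⟨v, hv, ?_⟩
    ext i
    have h1 : ∀ j, (aeval z) (M i j) * v j =
        (if i = j then (l : ℂ) * z * v j else 0) - (A i j : ℂ) * v j := by
      intro j
      simp only [hM, Matrix.add_apply, Matrix.smul_apply, Matrix.map_apply,
        Matrix.diagonal_apply, Matrix.neg_apply, smul_eq_mul]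
      split_ifs <;> simp <;> ring
    simp only [Matrix.mulVec, dotProduct, AlgHom.mapMatrix_apply, Matrix.map_apply, h1,
      Finset.sum_sub_distrib, heq]
    simp
  set g : ℕ[X] := C (2 ^ m) * X + C (2 ^ m) with hg
  have hdom : Dominated M.det (∑ _σ : Equiv.Perm ι, ∏ _i : ι, g) := by
    rw [Matrix.det_apply]
    refine Dominated.sum fun σ _ => (Dominated.prod fun i _ => ?_).units_smul _
    have hent : ∀ i j, Dominated (M i j) g := by
      intro i j k
      simp only [hM, hg, Matrix.add_apply, Matrix.smul_apply, Matrix.map_apply,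
        Matrix.neg_apply, smul_eq_mul, X_mul_C, coeff_add, coeff_C, coeff_C_mul, coeff_X,
        Matrix.diagonal_apply]
      rcases k with _ | _ | k
      · simpa using hA i j
      · by_cases hij : i = j
        · simpa [hij] using hlm
        · simp [hij]
      · simp
    exact hent _ _
  have heval : (∑ _σ : Equiv.Perm ι, ∏ _i : ι, g).eval 1 ≤ 2 ^ (D * (1 + D + m)) := by
    have hfac : (Fintype.card ι).factorial ≤ 2 ^ (D * D) :=
      calc (Fintype.card ι).factorial ≤ D.factorial := Nat.factorial_le hD
        _ ≤ D ^ D := Nat.factorial_le_pow D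
        _ ≤ (2 ^ D) ^ D := Nat.pow_le_pow_left Nat.lt_two_pow_self.le _
        _ = 2 ^ (D * D) := by rw [pow_mul]
    have hg1 : g.eval 1 = 2 ^ (m + 1) := by simp [hg]; ring
    simp only [Finset.prod_const, Finset.sum_const, Finset.card_univ, Fintype.card_perm,
      nsmul_eq_mul, eval_mul, eval_natCast, eval_pow, hg1, Nat.cast_id]
    calc _ ≤ 2 ^ (D * D) * (2 ^ (m + 1)) ^ D := by gcongr; exact Nat.one_le_two_pow
      _ = _ := by rw [← pow_mul, ← pow_add]; congr 1; ring
  have hcoeff : ∀ i, (M.det.coeff i).natAbs < 2 ^ (D * (1 + D + m) + 1) := fun i =>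
    ((hdom i).trans ((coeff_le_eval_one _ _).trans heval)).trans_lt
      (Nat.pow_lt_pow_right (by norm_num) (Nat.lt_succ_self _))
  refine ⟨M.det, hne, hroot, (polyBits_le (hdeg.trans hD) hcoeff).trans (le_of_eq (by ring))⟩

lemma IsEigen.neg {D m : ℕ} {z : ℂ} (h : IsEigen D m z) : IsEigen D m (-z) := by
  obtain ⟨ι, _, _, A, l, v, hD, hl, hlm, hA, hv, heq⟩ := h
  refine ⟨ι, inferInstance, inferInstance, -A, l, v, hD, hl, hlm, by simpa using hA, hv, ?_⟩
  intro i
  have := heq i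
  simp only [Matrix.neg_apply, Int.cast_neg, neg_mul, Finset.sum_neg_distrib]
  rw [this]
  ring

lemma prod_ne_zero_of_ne_zero {ι κ : Type*} {v : ι → ℂ} {w : κ → ℂ} (hv : v ≠ 0) (hw : w ≠ 0) :
    (fun x : ι × κ => v x.1 * w x.2) ≠ 0 := by
  obtain ⟨i, hi⟩ := Function.ne_iff.mp hv
  obtain ⟨k, hk⟩ := Function.ne_iff.mp hw
  exact Function.ne_iff.mpr ⟨(i, k), mul_ne_zero hi hk⟩

/-- The Kronecker product of the matrices acts on the tensor product of the eigenvectors. The extra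
bit only matches the bound for sums. -/
lemma IsEigen.mul {D E m m' : ℕ} {z w : ℂ} (hz : IsEigen D m z) (hw : IsEigen E m' w) :
    IsEigen (D * E) (m + m' + 1) (z * w) := by
  obtain ⟨ι, _, _, A, l, v, hD, hl, hlm, hA, hv, heq⟩ := hz
  obtain ⟨κ, _, _, B, l', v', hD', hl', hlm', hB, hv', heq'⟩ := hw
  have hb : ∀ {a b : ℤ}, a.natAbs ≤ 2 ^ m → b.natAbs ≤ 2 ^ m' →
      (a * b).natAbs ≤ 2 ^ (m + m' + 1) := by
    intro a b ha hb
    rw [Int.natAbs_mul, pow_succ, pow_add]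
    exact (Nat.mul_le_mul ha hb).trans (by omega)
  refine ⟨ι × κ, inferInstance, inferInstance, fun x y => A x.1 y.1 * B x.2 y.2, l * l',
    fun x => v x.1 * v' x.2, ?_, mul_ne_zero hl hl', hb hlm hlm', fun x y => hb (hA _ _) (hB _ _),
    prod_ne_zero_of_ne_zero hv hv', ?_⟩
  · rw [Fintype.card_prod]; exact Nat.mul_le_mul hD hD'
  · intro x
    have : ∀ y : ι × κ, ((A x.1 y.1 * B x.2 y.2 : ℤ) : ℂ) * (v y.1 * v' y.2) =
        (A x.1 y.1 * v y.1) * (B x.2 y.2 * v' y.2) := fun y => by push_cast; ring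
    simp_rw [this]
    rw [Fintype.sum_prod_type]
    dsimp only
    rw [← Fintype.sum_mul_sum, heq, heq']
    push_cast
    ring

/-- The Kronecker sum A ⊗ l′ + l ⊗ B acts on the tensor product of the eigenvectors; the extra bit
pays for the addition of two terms. -/
lemma IsEigen.add {D E m m' : ℕ} {z w : ℂ} (hz : IsEigen D m z) (hw : IsEigen E m' w) :
    IsEigen (D * E) (m + m' + 1) (z + w) := by
  obtain ⟨ι, _, _, A, l, v, hD, hl, hlm, hA, hv, heq⟩ := hz
  obtain ⟨κ, _, _, B, l', v', hD', hl', hlm', hB, hv', heq'⟩ := hw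
  have hb : ∀ {a b : ℤ}, a.natAbs ≤ 2 ^ m → b.natAbs ≤ 2 ^ m' →
      (a * b).natAbs ≤ 2 ^ (m + m') := by
    intro a b ha hb
    rw [Int.natAbs_mul, pow_add]
    exact Nat.mul_le_mul ha hb
  refine ⟨ι × κ, inferInstance, inferInstance, fun x y =>
    A x.1 y.1 * (if x.2 = y.2 then l' else 0) + (if x.1 = y.1 then l else 0) * B x.2 y.2, l * l',
    fun x => v x.1 * v' x.2, ?_, mul_ne_zero hl hl', ?_, fun x y => ?_,
    prod_ne_zero_of_ne_zero hv hv', ?_⟩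
  · rw [Fintype.card_prod]; exact Nat.mul_le_mul hD hD'
  · exact (hb hlm hlm').trans (Nat.pow_le_pow_right (by norm_num) (Nat.le_succ _))
  · dsimp only
    refine (Int.natAbs_add_le _ _).trans ?_
    rw [pow_succ, mul_two]
    refine Nat.add_le_add (hb (hA _ _) ?_) (hb ?_ (hB _ _)) <;> split_ifs <;> simp [hlm, hlm']
  · intro x
    have : ∀ (j : ι) (k : κ), ((A x.1 j * (if x.2 = k then l' else 0) +
        (if x.1 = j then l else 0) * B x.2 k : ℤ) : ℂ) * (v j * v' k) =
        (A x.1 j * v j) * (if x.2 = k then l' * v' k else 0) +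
        (if x.1 = j then l * v j else 0) * (B x.2 k * v' k) := fun j k => by
      split_ifs <;> push_cast <;> ring
    refine (Fintype.sum_prod_type _).trans ((Finset.sum_congr rfl fun j _ =>
      Finset.sum_congr rfl fun k _ => this j k).trans ?_)
    simp_rw [Finset.sum_add_distrib]
    rw [← Fintype.sum_mul_sum, ← Fintype.sum_mul_sum, heq, heq']
    simp
    ring

/-- A^k has the same eigenvector and the same order as A, and its entry length is linear in k.
Repeated use of `IsEigen.mul` would make the order exponential in k. -/
lemma IsEigen.pow {D m : ℕ} {z : ℂ} (h : IsEigen D m z) (k : ℕ) :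
    IsEigen D (k * (D + m)) (z ^ k) := by
  obtain ⟨ι, _, _, A, l, v, hD, hl, hlm, hA, hv, heq⟩ := h
  have hcard : Fintype.card ι ≤ 2 ^ D := hD.trans Nat.lt_two_pow_self.le
  refine ⟨ι, inferInstance, inferInstance, A ^ k, l ^ k, v, hD, pow_ne_zero _ hl, ?_, ?_, hv, ?_⟩
  · rw [Int.natAbs_pow]
    calc l.natAbs ^ k ≤ (2 ^ m) ^ k := Nat.pow_le_pow_left hlm k
      _ = 2 ^ (k * m) := by rw [← pow_mul, mul_comm]
      _ ≤ _ := Nat.pow_le_pow_right (by norm_num) (Nat.mul_le_mul_left _ (Nat.le_add_left _ _))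
  · induction k with
    | zero =>
      intro i j
      rw [pow_zero, Matrix.one_apply]
      split_ifs <;> simp
    | succ k ih =>
      intro i j
      rw [pow_succ, Matrix.mul_apply]
      refine (Int.natAbs_sum_le _ _).trans ?_
      calc ∑ x, ((A ^ k) i x * A x j).natAbs ≤ ∑ _x : ι, 2 ^ (k * (D + m)) * 2 ^ m :=
            Finset.sum_le_sum fun x _ => by
              rw [Int.natAbs_mul]; exact Nat.mul_le_mul (ih i x) (hA x j)
        _ = Fintype.card ι * (2 ^ (k * (D + m)) * 2 ^ m) := by simp
        _ ≤ 2 ^ D * (2 ^ (k * (D + m)) * 2 ^ m) := Nat.mul_le_mul_right _ hcard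
        _ = _ := by rw [← pow_add, ← pow_add]; congr 1; ring
  · induction k with
    | zero => intro i; simp [Matrix.one_apply]
    | succ k ih =>
      intro i
      rw [pow_succ]
      simp only [Matrix.mul_apply, Int.cast_sum, Int.cast_mul, Finset.sum_mul]
      rw [Finset.sum_comm]
      simp_rw [mul_assoc, ← Finset.mul_sum, heq]
      have : ∀ j, ((A ^ k) i j : ℂ) * (l * z * v j) = l * z * (((A ^ k) i j : ℂ) * v j) :=
        fun j => by ring
      simp_rw [this, ← Finset.mul_sum, ih]
      push_cast
      ring

/-- Reversing the coefficients inverts non-zero roots; zero is its own inverse by convention. -/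
lemma BitBound.inv {b : ℕ} {z : ℂ} (h : BitBound b z) : BitBound ((b + 1) * (1 + b)) z⁻¹ := by
  by_cases hz0 : z = 0
  · rw [hz0, inv_zero, ← hz0]
    exact h.mono (by nlinarith)
  obtain ⟨p, hp, hz, hb⟩ := h
  refine ⟨p.reverse, by simpa using hp, ?_, ?_⟩
  · let := invertibleOfNonzero hz0
    rw [← invOf_eq_inv]
    exact (eval₂_reverse_eq_zero_iff (algebraMap ℤ ℂ) z p).mpr hz
  · refine polyBits_le ((reverse_natDegree_le p).trans ((natDegree_lt_polyBits p).le.trans hb)) ?_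
    intro i
    rw [coeff_reverse]
    exact (natAbs_coeff_lt_two_pow p _).trans_le (Nat.pow_le_pow_right (by norm_num) hb)

/-- If p vanishes at z^m, then p(X^m) vanishes at z and has the same non-zero coefficients. -/
lemma BitBound.of_pow {b m : ℕ} {z : ℂ} (hm : m ≠ 0) (h : BitBound b (z ^ m)) :
    BitBound ((b * m + 1) * (1 + b)) z := by
  obtain ⟨p, hp, hz, hb⟩ := h
  refine ⟨expand ℤ m p, (expand_ne_zero (Nat.pos_of_ne_zero hm)).mpr hp, ?_, ?_⟩
  · rw [expand_aeval, hz]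
  · refine polyBits_le ?_ fun i => ?_
    · rw [natDegree_expand]
      exact Nat.mul_le_mul_right _ ((natDegree_lt_polyBits p).le.trans hb)
    · rw [coeff_expand (Nat.pos_of_ne_zero hm)]
      split_ifs
      · exact (natAbs_coeff_lt_two_pow p _).trans_le (Nat.pow_le_pow_right (by norm_num) hb)
      · simp

lemma bitBound_zero : BitBound 4 0 :=
  ⟨X, X_ne_zero, by simp, (polyBits_le (d := 1) (e := 1) (by simp) fun i => by
    rw [coeff_X]; split_ifs <;> simp)⟩

lemma bitBound_one : BitBound 4 1 := by
  refine ⟨X - C 1, X_sub_C_ne_zero 1, by simp,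
    (polyBits_le (d := 1) (e := 1) (natDegree_X_sub_C 1).le fun i => ?_)⟩
  rw [coeff_sub, coeff_X, coeff_C]
  rcases i with _ | _ | i <;> simp

lemma bitBound_I : BitBound 6 Complex.I := by
  refine ⟨X ^ 2 + C 1, X_pow_add_C_ne_zero (by norm_num) 1, by simp,
    (polyBits_le (d := 2) (e := 1) natDegree_X_pow_add_C.le fun i => ?_)⟩
  rw [coeff_add, coeff_X_pow, coeff_C]
  rcases i with _ | _ | _ | i <;> simp

end

/-! ### Cost models -/

/-- The growth of size levels under one machine operation. -/
def grow (k : ℕ) : ℕ := 12 * k + 22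

/-- A filtration of the complex numbers by size levels that controls the weight `w` polynomially in
the size parameter `N`. -/
structure SizeModel (w : ℂ → ℕ) (N : ℕ) where
  lvl : ℕ → ℂ → Prop
  weight_le {k : ℕ} {z : ℂ} : lvl k z → w z ≤ (N + 2) ^ k
  mono {k k' : ℕ} {z : ℂ} : lvl k z → k ≤ k' → lvl k' z
  zero : lvl 3 0
  one : lvl 3 1
  imag : lvl 3 Complex.I
  arith {k : ℕ} {y z : ℂ} (op : ArithOp) : lvl k y → lvl k z → lvl (grow k) (op.eval y z)
  root {k m : ℕ} {y : ℂ} : lvl k y → m ≤ (N + 2) ^ k → lvl (grow k) (y ^ ((m : ℂ)⁻¹))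
  pow {k m : ℕ} {y : ℂ} : lvl k y → m ≤ (N + 2) ^ k → lvl (grow k) (y ^ m)

/-- In the unit-cost measure all numbers have the same size. -/
def unitModel (N : ℕ) : SizeModel unitWeight N where
  lvl _ _ := True
  weight_le _ := Nat.zero_le _
  mono _ _ := trivial
  zero := trivial
  one := trivial
  imag := trivial
  arith _ _ _ := trivial
  root _ _ := trivial
  pow _ _ := trivial

/-- Sizes are measured by exponents of a base T ≥ 2, which reduces polynomial bookkeeping to linear
arithmetic on exponents. -/
lemma IsEigen.bitBound_pow {T a D m : ℕ} (hT : 2 ≤ T) {z : ℂ} (h : IsEigen D m z)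
    (hD : D ≤ T ^ a) (hm : m ≤ T ^ a) : BitBound (T ^ (3 * a + 4)) z := by
  refine h.bitBound.mono ?_
  have h1 : 1 ≤ T ^ a := Nat.one_le_pow _ _ (by omega)
  have e1 : D + 1 ≤ T ^ (a + 1) := by
    rw [pow_succ]; nlinarith
  have e2 : 1 + D + m ≤ T ^ (a + 2) := by
    have : 4 ≤ T ^ 2 := by nlinarith
    rw [pow_add]; nlinarith
  have e3 : 2 + D * (1 + D + m) ≤ T ^ (2 * a + 3) := by
    have h2 : D * (1 + D + m) ≤ T ^ (2 * a + 2) :=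
      (Nat.mul_le_mul hD e2).trans (le_of_eq (by rw [← pow_add]; congr 1; ring))
    have h3 : 2 ≤ T ^ (2 * a + 2) := hT.trans (Nat.le_self_pow (by omega) T)
    rw [pow_succ]; nlinarith
  exact (Nat.mul_le_mul e1 e3).trans (le_of_eq (by rw [← pow_add]; congr 1; ring))

section
variable {T k : ℕ} {y z : ℂ}

lemma two_mul_pow_succ_le (hT : 2 ≤ T) : T ^ k + T ^ k + 1 ≤ T ^ (2 * k + 2) := by
  have h1 : 1 ≤ T ^ k := Nat.one_le_pow _ _ (by omega)
  have h2 : T ^ k * T ^ 2 ≤ T ^ (2 * k + 2) := by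
    rw [← pow_add]; exact Nat.pow_le_pow_right (by omega) (by omega)
  have h3 : T ^ k * 4 ≤ T ^ k * T ^ 2 := Nat.mul_le_mul_left _ (by nlinarith)
  omega

lemma pow_mul_pow_le (hT : 2 ≤ T) : T ^ k * T ^ k ≤ T ^ (2 * k + 2) := by
  rw [← pow_add]; exact Nat.pow_le_pow_right (by omega) (by omega)

lemma BitBound.add (hT : 2 ≤ T) (hy : BitBound (T ^ k) y) (hz : BitBound (T ^ k) z) :
    BitBound (T ^ (6 * k + 10)) (y + z) :=
  ((hy.isEigen.add hz.isEigen).bitBound_pow hT (pow_mul_pow_le hT) (two_mul_pow_succ_le hT)).mono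
    (le_of_eq (by congr 1; ring))

lemma BitBound.sub (hT : 2 ≤ T) (hy : BitBound (T ^ k) y) (hz : BitBound (T ^ k) z) :
    BitBound (T ^ (6 * k + 10)) (y - z) := by
  rw [sub_eq_add_neg]
  exact ((hy.isEigen.add hz.isEigen.neg).bitBound_pow hT (pow_mul_pow_le hT)
    (two_mul_pow_succ_le hT)).mono (le_of_eq (by congr 1; ring))

lemma BitBound.mul (hT : 2 ≤ T) (hy : BitBound (T ^ k) y) (hz : BitBound (T ^ k) z) :
    BitBound (T ^ (6 * k + 10)) (y * z) :=
  ((hy.isEigen.mul hz.isEigen).bitBound_pow hT (pow_mul_pow_le hT) (two_mul_pow_succ_le hT)).mono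
    (le_of_eq (by congr 1; ring))

/-- This is the most expensive field operation in the size bounds: the inverse raises k to 2k + 2
and the product then gives 6(2k + 2) + 10, the value of `grow`. -/
lemma BitBound.div (hT : 2 ≤ T) (hy : BitBound (T ^ k) y) (hz : BitBound (T ^ k) z) :
    BitBound (T ^ (12 * k + 22)) (y / z) := by
  rw [div_eq_mul_inv]
  have h1 : 1 ≤ T ^ k := Nat.one_le_pow _ _ (by omega)
  have h2 : T ^ k + 1 ≤ T ^ (k + 1) := by rw [pow_succ]; nlinarith
  have hz' : BitBound (T ^ (2 * k + 2)) z⁻¹ := hz.inv.mono <| by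
    rw [add_comm 1]
    exact (Nat.mul_le_mul h2 h2).trans (le_of_eq (by rw [← pow_add]; congr 1; ring))
  have hy' : BitBound (T ^ (2 * k + 2)) y :=
    hy.mono (Nat.pow_le_pow_right (by omega) (by omega))
  exact (hy'.mul hT hz').mono (le_of_eq (by congr 1; ring))

end

/-- In the bit-cost measure the size level of an algebraic number is given by its bit size. -/
def bitModel (N : ℕ) : SizeModel bitSize N where
  lvl k z := BitBound ((N + 2) ^ k) z
  weight_le h := h.bitSize_le
  mono h hk := h.mono (Nat.pow_le_pow_right (by omega) hk)
  zero := bitBound_zero.mono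
    (le_trans (by norm_num) (Nat.pow_le_pow_left (show 2 ≤ N + 2 by omega) 3))
  one := bitBound_one.mono
    (le_trans (by norm_num) (Nat.pow_le_pow_left (show 2 ≤ N + 2 by omega) 3))
  imag := bitBound_I.mono
    (le_trans (by norm_num) (Nat.pow_le_pow_left (show 2 ≤ N + 2 by omega) 3))
  arith {k y z} op hy hz := by
    have hk : (N + 2) ^ (6 * k + 10) ≤ (N + 2) ^ (12 * k + 22) :=
      Nat.pow_le_pow_right (by omega) (by omega)
    cases op
    · exact (hy.add (by omega) hz).mono hk
    · exact (hy.sub (by omega) hz).mono hk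
    · exact (hy.mul (by omega) hz).mono hk
    · exact hy.div (by omega) hz
  root {k m y} hy hm := by
    -- For m = 0 the exponent is 0⁻¹ = 0, and the machine's root is 1.
    rcases eq_or_ne m 0 with rfl | hm0
    · simp only [Nat.cast_zero, inv_zero, Complex.cpow_zero]
      exact bitBound_one.mono (le_trans (by norm_num) ((Nat.pow_le_pow_left
        (show 2 ≤ N + 2 by omega) 3).trans (Nat.pow_le_pow_right (by omega)
          (by unfold grow; omega))))
    · have h : BitBound ((N + 2) ^ k) ((y ^ ((m : ℂ)⁻¹)) ^ m) := by
        rwa [Complex.cpow_nat_inv_pow _ hm0]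
      refine (h.of_pow hm0).mono ?_
      set T := N + 2
      have hT : 2 ≤ T := by omega
      have h1 : 1 ≤ T ^ k := Nat.one_le_pow _ _ (by omega)
      have h2 : 1 + T ^ k ≤ T ^ (k + 1) := by rw [pow_succ]; nlinarith
      have h3 : T ^ k * m + 1 ≤ T ^ (2 * k + 1) := by
        have : T ^ k * m ≤ T ^ (2 * k) :=
          (Nat.mul_le_mul_left _ hm).trans (le_of_eq (by rw [← pow_add]; congr 1; ring))
        have : 1 ≤ T ^ (2 * k) := Nat.one_le_pow _ _ (by omega)
        rw [pow_succ]; nlinarith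
      refine (Nat.mul_le_mul h3 h2).trans ?_
      rw [← pow_add]
      exact Nat.pow_le_pow_right (by omega) (by unfold grow; omega)
  pow {k m y} hy hm := by
    have hT : 2 ≤ N + 2 := by omega
    refine ((hy.isEigen.pow m).bitBound_pow (a := 2 * k + 1) hT
      (Nat.pow_le_pow_right (by omega) (by omega)) ?_).mono
      (Nat.pow_le_pow_right (by omega) (by unfold grow; omega))
    calc m * ((N + 2) ^ k + (N + 2) ^ k) ≤ (N + 2) ^ k * ((N + 2) ^ k * (N + 2)) := by
          gcongr; nlinarith [Nat.one_le_pow k (N + 2) (by omega)]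
      _ = _ := by rw [← pow_succ, ← pow_add]; congr 1; ring

/-! ### Programs without loops -/

/-- All numbers contained in the state have level at most `k`. -/
structure SizeModel.Bounds {w : ℂ → ℕ} {N : ℕ} (M : SizeModel w N) (k : ℕ) (s : State) : Prop where
  var (x : ℕ) : M.lvl k (s.var x)
  arr (j : ℕ) : M.lvl k (s.arr j)
  idx (i : ℕ) : s.idx i ≤ (N + 2) ^ k

lemma SizeModel.Bounds.mono {w : ℂ → ℕ} {N : ℕ} {M : SizeModel w N} {k k' : ℕ} {s : State}
    (h : M.Bounds k s) (hk : k ≤ k') : M.Bounds k' s :=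
  ⟨fun x => M.mono (h.var x) hk, fun x => M.mono (h.arr x) hk,
    fun i => (h.idx i).trans (Nat.pow_le_pow_right (by omega) hk)⟩

lemma le_grow (k : ℕ) : k ≤ grow k := by unfold grow; omega

lemma SizeModel.Bounds.update_idx {w : ℂ → ℕ} {N : ℕ} {M : SizeModel w N} {k : ℕ} {s : State}
    (h : M.Bounds k s) (i : ℕ) {m : ℕ} (hm : m ≤ (N + 2) ^ k + 1) :
    M.Bounds (grow k) { s with idx := Function.update s.idx i m } := by
  have h' := h.mono (le_grow k)
  refine ⟨h'.var, h'.arr, fun j => ?_⟩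
  dsimp only
  rw [Function.update_apply]
  split_ifs
  · refine hm.trans ?_
    calc (N + 2) ^ k + 1 ≤ (N + 2) ^ (k + 1) := by
          rw [pow_succ]; nlinarith [Nat.one_le_pow k (N + 2) (by omega)]
      _ ≤ _ := Nat.pow_le_pow_right (by omega) (by unfold grow; omega)
  · exact h'.idx j

lemma SizeModel.Bounds.update_var {w : ℂ → ℕ} {N : ℕ} {M : SizeModel w N} {k : ℕ} {s : State}
    (h : M.Bounds k s) (x : ℕ) {z : ℂ} (hz : M.lvl (grow k) z) :
    M.Bounds (grow k) { s with var := Function.update s.var x z } := by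
  have h' := h.mono (le_grow k)
  refine ⟨fun j => ?_, h'.arr, h'.idx⟩
  dsimp only
  rw [Function.update_apply]
  split_ifs
  · exact hz
  · exact h'.var j

lemma SizeModel.Bounds.next {w : ℂ → ℕ} {N : ℕ} {M : SizeModel w N} {k : ℕ} {s : State}
    (h : M.Bounds k s) (a : Instr) : M.Bounds (grow k) (a.next s) := by
  have h3 : 3 ≤ grow k := by unfold grow; omega
  cases a with
  | idxZero i => exact h.update_idx i (Nat.zero_le _)
  | idxInc i => exact h.update_idx i (Nat.succ_le_succ (h.idx i))
  | idxDec i => exact h.update_idx i (by have := h.idx i; omega)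
  | idxCopy i j => exact h.update_idx i ((h.idx j).trans (Nat.le_succ _))
  | one x => exact h.update_var x (M.mono M.one h3)
  | imag x => exact h.update_var x (M.mono M.imag h3)
  | arith op x y z => exact h.update_var x (M.arith op (h.var y) (h.var z))
  | root x y i => exact h.update_var x (M.root (h.var y) (h.idx i))
  | load x i => exact h.update_var x (M.mono (h.arr _) (le_grow k))
  | store i x =>
    have h' := h.mono (le_grow k)
    refine ⟨h'.var, fun j => ?_, h'.idx⟩
    simp only [Instr.next]
    rw [Function.update_apply]
    split_ifs
    · exact h'.var x
    · exact h'.arr j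

lemma SizeModel.Bounds.cost_le {w : ℂ → ℕ} {N : ℕ} {M : SizeModel w N} {k : ℕ} {s : State}
    (h : M.Bounds k s) (a : Instr) : a.cost w s ≤ (N + 2) ^ (grow k + 1) := by
  have h1 : 1 ≤ (N + 2) ^ (grow k + 1) := Nat.one_le_pow _ _ (by omega)
  have h2 : ∀ z, M.lvl (grow k) z → 1 + w z ≤ (N + 2) ^ (grow k + 1) := fun z hz => by
    rw [pow_succ]
    nlinarith [M.weight_le hz, Nat.one_le_pow (grow k) (N + 2) (by omega)]
  cases a <;> simp only [Instr.cost]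
  all_goals first
    | exact h1
    | exact h2 _ ((h.next _).var _)
    | exact h2 _ ((h.mono (le_grow k)).var _)

namespace Program

/-- A program without loops. -/
def LoopFree : Program → Prop
  | .instr _ => True
  | .comp c d => c.LoopFree ∧ d.LoopFree
  | .branch _ c d => c.LoopFree ∧ d.LoopFree
  | .loopUntil _ _ => False

open Classical in
/-- The final state of a program without loops. -/
def run : Program → State → State
  | .instr a, s => a.next s
  | .comp c d, s => d.run (c.run s)
  | .branch b c d, s => if b.Holds s then c.run s else d.run s
  | .loopUntil _ _, s => s

/-- Each instruction raises the level by a fixed function, so K depends only on the text and the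
initial level, not on the size parameter, the weight or the state. -/
lemma LoopFree.exists_runs {c : Program} (hc : c.LoopFree) (k : ℕ) :
    ∃ K, ∀ (w : ℂ → ℕ) (N : ℕ) (M : SizeModel w N) (s : State), M.Bounds k s →
      M.Bounds K (c.run s) ∧ ∃ t, Runs w c s (c.run s) t ∧ t ≤ (N + 2) ^ K := by
  induction c generalizing k with
  | instr a =>
    exact ⟨grow k + 1, fun w N M s h => ⟨(h.next a).mono (Nat.le_succ _), _, .instr a s,
      h.cost_le a⟩⟩
  | comp c d ihc ihd =>
    obtain ⟨K, hK⟩ := ihc hc.1 k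
    obtain ⟨K', hK'⟩ := ihd hc.2 K
    refine ⟨K + K' + 1, fun w N M s h => ?_⟩
    obtain ⟨h1, t, ht, hle⟩ := hK w N M s h
    obtain ⟨h2, t', ht', hle'⟩ := hK' w N M _ h1
    refine ⟨h2.mono (by omega), _, .comp ht ht', ?_⟩
    have e1 : (N + 2) ^ K ≤ (N + 2) ^ (K + K') := Nat.pow_le_pow_right (by omega) (by omega)
    have e2 : (N + 2) ^ K' ≤ (N + 2) ^ (K + K') := Nat.pow_le_pow_right (by omega) (by omega)
    rw [pow_succ]
    nlinarith
  | branch b c d ihc ihd =>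
    obtain ⟨K, hK⟩ := ihc hc.1 k
    obtain ⟨K', hK'⟩ := ihd hc.2 k
    refine ⟨K + K' + 1, fun w N M s h => ?_⟩
    have e1 : (N + 2) ^ K ≤ (N + 2) ^ (K + K') := Nat.pow_le_pow_right (by omega) (by omega)
    have e2 : (N + 2) ^ K' ≤ (N + 2) ^ (K + K') := Nat.pow_le_pow_right (by omega) (by omega)
    have e3 := Nat.one_le_pow (K + K') (N + 2) (by omega)
    by_cases hb : b.Holds s
    · obtain ⟨h1, t, ht, hle⟩ := hK w N M s h
      rw [run, if_pos hb]
      refine ⟨h1.mono (by omega), _, .branch_true hb ht, ?_⟩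
      rw [pow_succ]
      nlinarith
    · obtain ⟨h1, t, ht, hle⟩ := hK' w N M s h
      rw [run, if_neg hb]
      refine ⟨h1.mono (by omega), _, .branch_false hb ht, ?_⟩
      rw [pow_succ]
      nlinarith
  | loopUntil b c => exact hc.elim

lemma runs_loopUntil {w : ℂ → ℕ} {b : Test} {c : Program} {S : ℕ → State} {t : ℕ} {n : ℕ}
    (hb : ∀ j < n, ¬ b.Holds (S j)) (hn : b.Holds (S n))
    (hc : ∀ j < n, ∃ t', Runs w c (S j) (S (j + 1)) t' ∧ t' ≤ t) :
    ∃ t', Runs w (.loopUntil b c) (S 0) (S n) t' ∧ t' ≤ n * (1 + t) + 1 := by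
  induction n generalizing S with
  | zero => exact ⟨1, .loop_exit hn, by omega⟩
  | succ n ih =>
    obtain ⟨t₁, h₁, hle₁⟩ := hc 0 (by omega)
    obtain ⟨t₂, h₂, hle₂⟩ := ih (S := fun j => S (j + 1)) (fun j hj => hb (j + 1) (by omega)) hn
      (fun j hj => hc (j + 1) (by omega))
    refine ⟨_, .loop_next (hb 0 (by omega)) h₁ h₂, ?_⟩
    rw [add_mul]
    omega

/-- A loop that runs at most `N` times through states of bounded level. -/
lemma LoopFree.exists_runs_loopUntil {c : Program} (hc : c.LoopFree) (k : ℕ) :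
    ∃ K, ∀ (w : ℂ → ℕ) (N : ℕ) (M : SizeModel w N) (b : Test) (n : ℕ) (s : State),
      n ≤ N → (∀ j < n, ¬ b.Holds (c.run^[j] s)) → b.Holds (c.run^[n] s) →
      (∀ j ≤ n, M.Bounds k (c.run^[j] s)) →
      M.Bounds K (c.run^[n] s) ∧
        ∃ t, Runs w (.loopUntil b c) s (c.run^[n] s) t ∧ t ≤ (N + 2) ^ K := by
  obtain ⟨K, hK⟩ := hc.exists_runs k
  refine ⟨k + K + 2, fun w N M b n s hnN hb hn hB => ⟨(hB n le_rfl).mono (by omega), ?_⟩⟩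
  obtain ⟨t, ht, hle⟩ := runs_loopUntil (w := w) (b := b) (c := c) (S := fun j => c.run^[j] s)
    (t := (N + 2) ^ K) (n := n) hb hn fun j hj => by
      obtain ⟨-, t, ht, hle⟩ := hK w N M _ (hB j hj.le)
      refine ⟨t, ?_, hle⟩
      rwa [Function.iterate_succ_apply']
  refine ⟨t, ht, hle.trans ?_⟩
  have h1 := Nat.one_le_pow K (N + 2) (by omega)
  have h2 : n * (1 + (N + 2) ^ K) ≤ N * ((N + 2) ^ K + (N + 2) ^ K) :=
    Nat.mul_le_mul hnN (by omega)
  calc n * (1 + (N + 2) ^ K) + 1 ≤ (N + 2) ^ K * (N + 2) * (N + 2) := by nlinarith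
    _ = (N + 2) ^ (K + 2) := by ring
    _ ≤ _ := Nat.pow_le_pow_right (by omega) (by omega)

end Program

/-! ### The program -/

namespace Program

/-- An instruction without effect, since index register `8` always contains `0`. -/
def skip : Program := .instr (.idxZero 8)

/-- A sequence of instructions. -/
def block : List Instr → Program
  | [] => skip
  | a :: l => .comp (.instr a) (block l)

lemma loopFree_block (l : List Instr) : (block l).LoopFree := by
  induction l with
  | nil => exact trivial
  | cons a l ih => exact ⟨trivial, ih⟩

end Program

open Program

-- Index registers: 0 holds n, 1–3 the answers, 4 the position, 5 a mismatch flag, 6 the flag for u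
-- = (0,1), 7 the constant 2 for square roots, 8 the constant 0. Scalars: 0–3 the output; 4, 5 and
-- 6, 7 the vectors u and v; 8, 9 their coefficients; 10–12 the products u·u, v·v, u·v; 13 and 14
-- the bases whose powers accumulate in 17 and 18; 15, 16 the two terms of the current entry; 19
-- scratch. Register 30 is never written, so adding it copies and subtracting from it negates.
local notation "addI" => Instr.arith ArithOp.add
local notation "subI" => Instr.arith ArithOp.sub
local notation "mulI" => Instr.arith ArithOp.mul
local notation "divI" => Instr.arith ArithOp.div

/-- Load `f₀, …, f₃` into registers `20, …, 23` and compute `f₀ f₂ - f₁²`. -/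
def setup : Program := block
  [.idxInc 7, .idxInc 7, .load 20 4, .idxInc 4, .load 21 4, .idxInc 4, .load 22 4, .idxInc 4,
    .load 23 4, .idxZero 4, mulI 24 20 22, mulI 25 21 21, subI 24 24 25]

/-- The candidate decomposition with `u = (0, 1)`, except for the coefficient of `u`. -/
def infiniteSlope : Program := block
  [.one 5, .one 6, divI 7 21 20, addI 9 20 30, .idxInc 6]

/-- The candidate decomposition with `u = (1, μ)` and `v = (1, ν)`. -/
def finiteSlopes : Program := block
  [mulI 25 21 22, mulI 27 20 23, subI 25 25 27, mulI 26 21 23, mulI 27 22 22, subI 26 26 27,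
    mulI 27 25 25, mulI 28 26 24, addI 28 28 28, addI 28 28 28, subI 27 27 28, .root 27 27 7,
    addI 28 24 24, subI 25 30 25, .one 4, .one 6, addI 5 25 27, divI 5 5 28, subI 7 25 27,
    divI 7 7 28, mulI 29 20 7, subI 29 21 29, subI 28 5 7, divI 8 29 28, subI 9 20 8]

/-- Compute the inner products, and initialize the loop. -/
def prepare : Program := block
  [mulI 10 4 4, mulI 29 5 5, addI 10 10 29, mulI 11 6 6, mulI 29 7 7, addI 11 11 29,
    mulI 12 4 6, mulI 29 5 7, addI 12 12 29, divI 13 11 10, .one 14, subI 14 30 14,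
    addI 15 8 30, addI 16 9 30, .one 17, .one 18, .one 19]

/-- The computations before the loop. -/
def precompute : Program :=
  .comp setup (.comp (.branch (.isZero 24) infiniteSlope finiteSlopes) prepare)

/-- The body of the loop: compare one entry with the candidate decomposition. -/
def compareEntry : Program :=
  .comp (block [.load 19 4, subI 19 19 15, subI 19 19 16])
    (.comp (.branch (.isZero 19) skip (block [.idxZero 5, .idxInc 5]))
      (block [.one 19, mulI 15 15 5, mulI 16 16 7, mulI 17 17 13, mulI 18 18 14, .idxInc 4]))

/-- Treat the last entry: compare it, or obtain from it the coefficient of `u = (0, 1)`. -/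
def lastEntry : Program :=
  .comp (block [.load 19 4, subI 19 19 15, subI 19 19 16])
    (.branch (.idxEq 6 8) (.branch (.isZero 19) skip (.instr (.idxInc 5)))
      (.instr (addI 8 19 30)))

/-- An n-th root followed by a square root yields l with l^{2n} = c₁/c₂. -/
def outputTwo : Program := block
  [divI 20 8 9, .root 20 20 0, .root 20 20 7, .one 21, divI 22 21 20, addI 21 21 21,
    addI 23 20 22, divI 0 23 21, subI 23 20 22, mulI 24 21 5, divI 1 23 24, subI 2 30 1,
    addI 3 0 30, .idxInc 2]

/-- Normalize the two vectors, and compute the fourth power of the ratio of their coefficients. -/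
def normalize : Program := block
  [.root 20 10 7, .root 21 11 7, divI 22 4 20, divI 23 5 20, divI 24 6 21, divI 25 7 21,
    divI 26 9 8, mulI 26 26 26, mulI 26 26 26, mulI 27 17 17, mulI 26 26 27, .one 31]

def outputOne : Program := block
  [addI 27 31 31, .root 27 27 7, addI 28 22 24, divI 0 28 27, subI 28 22 24, divI 1 28 27,
    addI 28 23 25, divI 2 28 27, subI 28 23 25, divI 3 28 27, .idxInc 1]

/-- The product (ρ − 1)(ρ − (−1)^n) tests both admissible fourth powers at once. -/
def classifyOne : Program :=
  .comp (block [subI 27 26 31, subI 28 26 18, mulI 27 27 28])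
    (.branch (.isZero 27) outputOne skip)

def outputThree : Program := block
  [mulI 24 28 24, mulI 25 28 25, addI 27 31 29, .root 27 27 7, .root 29 29 7, addI 32 31 31,
    mulI 33 32 29, addI 28 22 24, mulI 28 27 28, divI 0 28 32, subI 28 22 24, mulI 28 27 28,
    divI 1 28 33, addI 28 23 25, mulI 28 27 28, divI 2 28 32, subI 28 23 25, mulI 28 27 28,
    divI 3 28 33, .idxInc 3]

/-- With w = i(u·v)/(st), the condition w² = 1 encodes (u·v)² = −(u·u)(v·v), and w is the sign that
the output needs. -/
def classifyThree : Program :=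
  .comp (block [mulI 27 20 21, .imag 29, mulI 28 29 12, divI 28 28 27, mulI 32 28 28,
    subI 32 32 31, subI 33 26 31])
    (.branch (.isZero 32) (.branch (.isZero 33) outputThree skip) skip)

/-- Decide membership from a decomposition. -/
def classify : Program :=
  .branch (.isZero 10)
    (.branch (.isZero 11) outputTwo skip)
    (.branch (.isZero 11) skip
      (.comp normalize (.branch (.isZero 12) classifyOne classifyThree)))

def finish : Program := .comp lastEntry (.branch (.idxEq 5 8) classify skip)

/-- The whole algorithm. -/
def decideA : Program :=
  .comp precompute (.comp (.loopUntil (.idxEq 4 0) compareEntry) finish)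

lemma loopFree_precompute : precompute.LoopFree :=
  ⟨loopFree_block _, ⟨loopFree_block _, loopFree_block _⟩, loopFree_block _⟩

lemma loopFree_compareEntry : compareEntry.LoopFree :=
  ⟨loopFree_block _, ⟨trivial, loopFree_block _⟩, loopFree_block _⟩

lemma loopFree_finish : finish.LoopFree :=
  ⟨⟨loopFree_block _, ⟨trivial, trivial⟩, trivial⟩,
    ⟨⟨loopFree_block _, trivial⟩, trivial, loopFree_block _,
      ⟨loopFree_block _, loopFree_block _, trivial⟩,
      loopFree_block _, ⟨loopFree_block _, trivial⟩, trivial⟩, trivial⟩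

/-! ### Correctness of the classification -/

/-- The state contains the correct answer for the signature `f`. -/
def Correct {n : ℕ} (f : Fin (n + 1) → ℂ) (s : State) : Prop :=
  ∀ k ∈ ({1, 2, 3} : Finset ℕ),
    (MemA k f → s.idx k = 1 ∧ MemAWith k f s.outputMatrix) ∧ (¬ MemA k f → s.idx k = 0)

/-- By exclusivity, one certified class also settles the negative answers for the other two. -/
lemma correct_of_memAWith {n : ℕ} (hn : 3 ≤ n) {f : Fin (n + 1) → ℂ} {s : State} {k : ℕ}
    (hk : k ∈ ({1, 2, 3} : Finset ℕ)) (h : MemAWith k f s.outputMatrix)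
    (h1 : s.idx 1 = if k = 1 then 1 else 0) (h2 : s.idx 2 = if k = 2 then 1 else 0)
    (h3 : s.idx 3 = if k = 3 then 1 else 0) : Correct f s := by
  have hidx : ∀ j ∈ ({1, 2, 3} : Finset ℕ), s.idx j = if k = j then 1 else 0 := by
    intro j hj
    simp only [Finset.mem_insert, Finset.mem_singleton] at hj
    rcases hj with rfl | rfl | rfl <;> assumption
  intro j hj
  refine ⟨fun hm => ?_, fun hm => ?_⟩
  · obtain rfl := eq_of_memA hn hk hj ⟨_, h⟩ hm
    exact ⟨by rw [hidx k hk, if_pos rfl], h⟩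
  · rw [hidx j hj, if_neg]
    rintro rfl
    exact hm ⟨_, h⟩

lemma correct_of_not_memA {n : ℕ} {f : Fin (n + 1) → ℂ} {s : State}
    (h : ∀ k ∈ ({1, 2, 3} : Finset ℕ), ¬ MemA k f)
    (h1 : s.idx 1 = 0) (h2 : s.idx 2 = 0) (h3 : s.idx 3 = 0) : Correct f s := by
  intro j hj
  refine ⟨fun hm => (h j hj hm).elim, fun _ => ?_⟩
  simp only [Finset.mem_insert, Finset.mem_singleton] at hj
  rcases hj with rfl | rfl | rfl <;> assumption

/-- The state contains a decomposition of `f`, with the data that `classify` needs. -/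
structure Decomposed {n : ℕ} (f : Fin (n + 1) → ℂ) (s : State) : Prop where
  idx_zero : s.idx 0 = n
  idx_one : s.idx 1 = 0
  idx_two : s.idx 2 = 0
  idx_three : s.idx 3 = 0
  idx_seven : s.idx 7 = 2
  var_thirty : s.var 30 = 0
  decomposes : Decomposes f (s.var 8) ![s.var 4, s.var 5] (s.var 9) ![s.var 6, s.var 7]
  uu : s.var 10 = dot₂ ![s.var 4, s.var 5] ![s.var 4, s.var 5]
  vv : s.var 11 = dot₂ ![s.var 6, s.var 7] ![s.var 6, s.var 7]
  uv : s.var 12 = dot₂ ![s.var 4, s.var 5] ![s.var 6, s.var 7]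
  ratio : s.var 17 = (s.var 11 / s.var 10) ^ n
  sign : s.var 18 = (-1) ^ n
  slope : s.var 6 = 1 ∧ (s.var 10 = 0 → s.var 4 = 1)

lemma run_branch (b : Test) (c d : Program) (s : State) :
    (Program.branch b c d).run s = open Classical in if b.Holds s then c.run s else d.run s := rfl

lemma sqrt_sq (z : ℂ) {m : ℕ} (hm : m = 2) : (z ^ ((m : ℂ)⁻¹)) ^ 2 = z := by
  subst hm; exact Complex.cpow_nat_inv_pow z two_ne_zero

/-- The principal branch gives α itself and not −α, so the machine's output is literally the matrix
of `memAWith_three`. -/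
lemma sqrt_I {m : ℕ} (hm : m = 2) : Complex.I ^ ((m : ℂ)⁻¹) = alpha := by
  subst hm
  rw [Complex.cpow_def_of_ne_zero Complex.I_ne_zero, Complex.log_I, alpha]
  congr 1
  push_cast
  ring

section
variable {n : ℕ} {f : Fin (n + 1) → ℂ} {s : State}

lemma Decomposed.correct_outputTwo (hn : 3 ≤ n) (h : Decomposed f s) (hu : s.var 10 = 0)
    (hv : s.var 11 = 0) : Correct f (outputTwo.run s) := by
  -- Running a concrete block on an unknown state unfolds definitionally, so symbolic execution is
  -- `rfl`.
  have hm : (outputTwo.run s).outputMatrix =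
    let l := ((s.var 8 / s.var 9) ^ ((s.idx 0 : ℂ)⁻¹)) ^ ((s.idx 7 : ℂ)⁻¹)
    !![(l + 1 / l) / (1 + 1), (l - 1 / l) / ((1 + 1) * s.var 5);
      s.var 30 - (l - 1 / l) / ((1 + 1) * s.var 5), (l + 1 / l) / (1 + 1) + s.var 30] := rfl
  refine correct_of_memAWith hn (k := 2) (by simp) ?_ h.idx_one ?_ h.idx_three
  · have key := memAWith_two (l := ((s.var 8 / s.var 9) ^ ((s.idx 0 : ℂ)⁻¹)) ^ ((s.idx 7 : ℂ)⁻¹))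
      (by omega) h.decomposes ⟨h.uu ▸ hu, h.vv ▸ hv⟩ (h.slope.2 hu) h.slope.1 (by
        rw [pow_mul, sqrt_sq _ h.idx_seven, h.idx_zero, Complex.cpow_nat_inv_pow _ (by omega)])
    rw [hm, h.var_thirty]
    simp only [zero_sub, add_zero, one_add_one_eq_two]
    exact key
  · have : (outputTwo.run s).idx 2 = s.idx 2 + 1 := rfl
    rw [this, h.idx_two]; rfl

lemma Decomposed.criterion (hn : 3 ≤ n) (h : Decomposed f s) {k : ℕ}
    (hk : k ∈ ({1, 2, 3} : Finset ℕ)) (hf : MemA k f) :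
    Criterion k n (s.var 8) ![s.var 4, s.var 5] (s.var 9) ![s.var 6, s.var 7] :=
  h.decomposes.criterion_of_memA hn hk hf

lemma Decomposed.correct_of_not_criterion (hn : 3 ≤ n) (h : Decomposed f s) {s' : State}
    (h' : ∀ k ∈ ({1, 2, 3} : Finset ℕ),
      ¬ Criterion k n (s.var 8) ![s.var 4, s.var 5] (s.var 9) ![s.var 6, s.var 7])
    (h1 : s'.idx 1 = s.idx 1) (h2 : s'.idx 2 = s.idx 2) (h3 : s'.idx 3 = s.idx 3) :
    Correct f s' :=
  correct_of_not_memA (fun k hk hf => h' k hk (h.criterion hn hk hf)) (h1.trans h.idx_one)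
    (h2.trans h.idx_two) (h3.trans h.idx_three)

/-- The fourth power of the ratio of the coefficients, up to normalization. -/
def ratioPow (n : ℕ) (c₁ U c₂ V : ℂ) : ℂ :=
  c₂ / c₁ * (c₂ / c₁) * (c₂ / c₁ * (c₂ / c₁)) * ((V / U) ^ n * (V / U) ^ n)

/-- The machine tests a quotient built from the accumulated power of V/U; clearing denominators
recovers the form used in `Criterion`. -/
lemma ratioPow_eq_iff {c₁ c₂ U V e : ℂ} (hc : c₁ ≠ 0) (hU : U ≠ 0) :
    ratioPow n c₁ U c₂ V = e ↔ c₂ ^ 4 * V ^ (2 * n) = e * (c₁ ^ 4 * U ^ (2 * n)) := by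
  have hU' := pow_ne_zero n hU
  have : ratioPow n c₁ U c₂ V = c₂ ^ 4 * V ^ (2 * n) / (c₁ ^ 4 * U ^ (2 * n)) := by
    unfold ratioPow
    rw [two_mul n, pow_add, pow_add, div_pow]
    field_simp
  rw [this, div_eq_iff (by positivity)]

/-- The state after `normalize`. -/
structure Normalized {n : ℕ} (f : Fin (n + 1) → ℂ) (s : State) : Prop
    extends Decomposed f s where
  uu_ne : s.var 10 ≠ 0
  vv_ne : s.var 11 ≠ 0
  sqrt_uu : s.var 20 ^ 2 = s.var 10
  sqrt_vv : s.var 21 ^ 2 = s.var 11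
  u_zero : s.var 22 = s.var 4 / s.var 20
  u_one : s.var 23 = s.var 5 / s.var 20
  v_zero : s.var 24 = s.var 6 / s.var 21
  v_one : s.var 25 = s.var 7 / s.var 21
  ratioPow : s.var 26 = ratioPow n (s.var 8) (s.var 10) (s.var 9) (s.var 11)
  one : s.var 31 = 1

lemma Decomposed.normalized (h : Decomposed f s) (hu : s.var 10 ≠ 0) (hv : s.var 11 ≠ 0) :
    Normalized f (normalize.run s) where
  idx_zero := h.idx_zero
  idx_one := h.idx_one
  idx_two := h.idx_two
  idx_three := h.idx_three
  idx_seven := h.idx_seven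
  var_thirty := h.var_thirty
  decomposes := h.decomposes
  uu := h.uu
  vv := h.vv
  uv := h.uv
  ratio := h.ratio
  sign := h.sign
  slope := h.slope
  uu_ne := hu
  vv_ne := hv
  sqrt_uu := sqrt_sq (s.var 10) h.idx_seven
  sqrt_vv := sqrt_sq (s.var 11) h.idx_seven
  u_zero := rfl
  u_one := rfl
  v_zero := rfl
  v_one := rfl
  ratioPow := by
    have : (normalize.run s).var 26 = s.var 9 / s.var 8 * (s.var 9 / s.var 8) *
      (s.var 9 / s.var 8 * (s.var 9 / s.var 8)) * (s.var 17 * s.var 17) := rfl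
    rw [this, h.ratio]
    rfl
  one := rfl

lemma Normalized.correct_classifyOne (hn : 3 ≤ n) (h : Normalized f s) (huv : s.var 12 = 0) :
    Correct f (classifyOne.run s) := by
  have hu : dot₂ ![s.var 4, s.var 5] ![s.var 4, s.var 5] ≠ 0 := h.uu ▸ h.uu_ne
  have hv : dot₂ ![s.var 6, s.var 7] ![s.var 6, s.var 7] ≠ 0 := h.vv ▸ h.vv_ne
  have huv' : dot₂ ![s.var 4, s.var 5] ![s.var 6, s.var 7] = 0 := h.uv ▸ huv
  have hρ := fun e => ratioPow_eq_iff (n := n) (c₂ := s.var 9) (V := s.var 11) (e := e)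
    h.decomposes.left_ne h.uu_ne
  rw [h.uu, h.vv] at hρ
  have hr := h.ratioPow
  rw [h.uu, h.vv] at hr
  rw [classifyOne, Program.run, run_branch]
  generalize hs' : (block [subI 27 26 31, subI 28 26 18, mulI 27 27 28]).run s = s'
  have hz : (Test.isZero 27).Holds s' ↔ (s.var 26 = 1 ∨ s.var 26 = (-1) ^ n) := by
    have : s'.var 27 = (s.var 26 - s.var 31) * (s.var 26 - s.var 18) := by rw [← hs']; rfl
    rw [Test.Holds, this, h.one, h.sign, mul_eq_zero, sub_eq_zero, sub_eq_zero]
  split_ifs with ht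
  · have hm : (outputOne.run s').outputMatrix =
      let τ := (s.var 31 + s.var 31) ^ ((s.idx 7 : ℂ)⁻¹)
      !![(s.var 22 + s.var 24) / τ, (s.var 22 - s.var 24) / τ;
        (s.var 23 + s.var 25) / τ, (s.var 23 - s.var 25) / τ] := by rw [← hs']; rfl
    refine correct_of_memAWith hn (k := 1) (by simp) ?_ ?_ (by rw [← hs']; exact h.idx_two)
      (by rw [← hs']; exact h.idx_three)
    · have key := memAWith_one (τ := (s.var 31 + s.var 31) ^ ((s.idx 7 : ℂ)⁻¹))
        h.decomposes ⟨hu, hv, huv', _, hz.mp ht, (hρ _).mp hr.symm⟩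
        (h.sqrt_uu.trans h.uu) (h.sqrt_vv.trans h.vv)
        (by rw [sqrt_sq _ h.idx_seven, h.one, one_add_one_eq_two])
      rw [hm, h.u_zero, h.u_one, h.v_zero, h.v_one]
      exact key
    · have : (outputOne.run s').idx 1 = s.idx 1 + 1 := by rw [← hs']; rfl
      rw [this, h.idx_one]; rfl
  · refine h.correct_of_not_criterion hn (fun k hk hC => ?_) (by rw [← hs']; rfl)
      (by rw [← hs']; rfl) (by rw [← hs']; rfl)
    simp only [Finset.mem_insert, Finset.mem_singleton] at hk
    rcases hk with rfl | rfl | rfl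
    · obtain ⟨-, -, -, e, he, hC⟩ := hC
      have := hr.trans ((hρ e).mpr hC)
      exact ht (hz.mpr (this ▸ he))
    · exact hu hC.1
    · have := hC.2.2.1
      rw [huv'] at this
      have h0 := neg_ne_zero.mpr (mul_ne_zero hu hv)
      exact h0 (by rw [← this]; norm_num)

lemma Normalized.correct_classifyThree (hn : 3 ≤ n) (h : Normalized f s) (huv : s.var 12 ≠ 0) :
    Correct f (classifyThree.run s) := by
  have hu : dot₂ ![s.var 4, s.var 5] ![s.var 4, s.var 5] ≠ 0 := h.uu ▸ h.uu_ne
  have hv : dot₂ ![s.var 6, s.var 7] ![s.var 6, s.var 7] ≠ 0 := h.vv ▸ h.vv_ne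
  have huv' : dot₂ ![s.var 4, s.var 5] ![s.var 6, s.var 7] ≠ 0 := h.uv ▸ huv
  have hρ := ratioPow_eq_iff (n := n) (c₂ := s.var 9) (V := s.var 11) (e := 1)
    h.decomposes.left_ne h.uu_ne
  rw [h.uu, h.vv, one_mul] at hρ
  have hr := h.ratioPow
  rw [h.uu, h.vv] at hr
  rw [← hr] at hρ
  have hw : ∀ w, w = Complex.I * s.var 12 / (s.var 20 * s.var 21) →
      (w * w = 1 ↔ s.var 12 ^ 2 = -(s.var 10 * s.var 11)) := by
    rintro w rfl
    have h1 := h.uu_ne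
    have h2 := h.vv_ne
    rw [← sq, div_pow, mul_pow, mul_pow, h.sqrt_uu, h.sqrt_vv, Complex.I_sq,
      div_eq_one_iff_eq (mul_ne_zero h1 h2)]
    constructor <;> intro h <;> linear_combination -h
  rw [classifyThree, Program.run, run_branch, run_branch]
  generalize hs' : (block [mulI 27 20 21, .imag 29, mulI 28 29 12, divI 28 28 27, mulI 32 28 28,
    subI 32 32 31, subI 33 26 31]).run s = s'
  have hw28 : s'.var 28 = Complex.I * s.var 12 / (s.var 20 * s.var 21) := by rw [← hs']; rfl
  have hz : (Test.isZero 32).Holds s' ↔ dot₂ ![s.var 4, s.var 5] ![s.var 6, s.var 7] ^ 2 =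
      -(dot₂ ![s.var 4, s.var 5] ![s.var 4, s.var 5] *
        dot₂ ![s.var 6, s.var 7] ![s.var 6, s.var 7]) := by
    have : s'.var 32 = s'.var 28 * s'.var 28 - s.var 31 := by rw [← hs']; rfl
    rw [Test.Holds, this, h.one, sub_eq_zero, hw _ hw28, h.uu, h.vv, h.uv]
  have hz' : (Test.isZero 33).Holds s' ↔ s.var 26 = 1 := by
    have : s'.var 33 = s.var 26 - s.var 31 := by rw [← hs']; rfl
    rw [Test.Holds, this, h.one, sub_eq_zero]
  have hnot : ¬ ((Test.isZero 32).Holds s' ∧ (Test.isZero 33).Holds s') →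
      Correct f (skip.run s') := by
    intro ht
    refine h.correct_of_not_criterion hn (fun k hk hC => ht ?_) (by rw [← hs']; rfl)
      (by rw [← hs']; rfl) (by rw [← hs']; rfl)
    simp only [Finset.mem_insert, Finset.mem_singleton] at hk
    rcases hk with rfl | rfl | rfl
    · exact (huv' hC.2.2.1).elim
    · exact (hu hC.1).elim
    · exact ⟨hz.mpr hC.2.2.1, hz'.mpr (hρ.mpr hC.2.2.2)⟩
  split_ifs with ht ht'
  · have hm : (outputThree.run s').outputMatrix =
      let η := (s.var 31 + Complex.I) ^ ((s.idx 7 : ℂ)⁻¹)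
      let β := Complex.I ^ ((s.idx 7 : ℂ)⁻¹)
      let w := s'.var 28
      !![η * (s.var 22 + w * s.var 24) / (s.var 31 + s.var 31),
          η * (s.var 22 - w * s.var 24) / ((s.var 31 + s.var 31) * β);
        η * (s.var 23 + w * s.var 25) / (s.var 31 + s.var 31),
          η * (s.var 23 - w * s.var 25) / ((s.var 31 + s.var 31) * β)] := by
      rw [← hs']; rfl
    refine correct_of_memAWith hn (k := 3) (by simp) ?_ (by rw [← hs']; exact h.idx_one)
      (by rw [← hs']; exact h.idx_two) ?_
    · have key := memAWith_three (η := (s.var 31 + Complex.I) ^ ((s.idx 7 : ℂ)⁻¹))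
        h.decomposes ⟨hu, hv, hz.mp ht, hρ.mp (hz'.mp ht')⟩
        (h.sqrt_uu.trans h.uu) (h.sqrt_vv.trans h.vv)
        (by rw [sqrt_sq _ h.idx_seven, h.one]) (h.uv ▸ hw28)
      simp only [hm, sqrt_I h.idx_seven]
      rw [h.u_zero, h.u_one, h.v_zero, h.v_one]
      rw [h.one, one_add_one_eq_two] at *
      exact key
    · have : (outputThree.run s').idx 3 = s.idx 3 + 1 := by rw [← hs']; rfl
      rw [this, h.idx_three]; rfl
  · exact hnot fun h => ht' h.2
  · exact hnot fun h => ht h.1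

lemma Decomposed.correct_classify (hn : 3 ≤ n) (h : Decomposed f s) :
    Correct f (classify.run s) := by
  -- Exactly one isotropic vector is incompatible with all three classes.
  have hskip : (s.var 10 = 0 ↔ ¬ s.var 11 = 0) → Correct f (skip.run s) := by
    rw [h.uu, h.vv]
    intro h0
    refine h.correct_of_not_criterion hn (fun k hk hC => ?_) rfl rfl rfl
    simp only [Finset.mem_insert, Finset.mem_singleton] at hk
    rcases hk with rfl | rfl | rfl
    · exact hC.1 (h0.mpr hC.2.1)
    · exact h0.mp hC.1 hC.2
    · exact hC.1 (h0.mpr hC.2.1)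
  rw [classify, run_branch, run_branch, run_branch]
  split_ifs with h1 h2 h2
  · exact h.correct_outputTwo hn h1 h2
  · exact hskip ⟨fun _ => h2, fun _ => h1⟩
  · exact hskip ⟨fun h => (h1 h).elim, fun h => (h h2).elim⟩
  · have h' := h.normalized h1 h2
    rw [Program.run, run_branch]
    split_ifs with h3
    · exact h'.correct_classifyOne hn h3
    · exact h'.correct_classifyThree hn h3

end

section

open Program

/-! ### Correctness of the search for a decomposition -/

/-- The entries of a signature as a sequence. -/
def entry {n : ℕ} (f : Fin (n + 1) → ℂ) : ℕ → ℂ := (inputState f).arr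

lemma entry_coe {n : ℕ} (f : Fin (n + 1) → ℂ) : (fun j : Fin (n + 1) => entry f j) = f := by
  ext j
  exact dif_pos j.2

lemma MemA.exists_decomposes {k n : ℕ} (hk : k ∈ ({1, 2, 3} : Finset ℕ)) {f : Fin (n + 1) → ℂ}
    (h : MemA k f) :
    ∃ c₁ u c₂ v, Decomposes (fun j : Fin (n + 1) => entry f j) c₁ u c₂ v := by
  obtain ⟨H, hH⟩ := h
  obtain ⟨c, ε, -, hd⟩ := hH.decomposes hk
  exact ⟨_, _, _, _, by rwa [entry_coe]⟩

/-- The entry `f_j` agrees with the candidate decomposition in the state. -/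
def Agrees {n : ℕ} (f : Fin (n + 1) → ℂ) (s : State) (j : ℕ) : Prop :=
  entry f j = s.var 8 * s.var 5 ^ j + s.var 9 * s.var 7 ^ j

/-- The state contains the only candidate for a decomposition of `f`. -/
def Candidate {n : ℕ} (f : Fin (n + 1) → ℂ) (s : State) : Prop :=
  s.var 6 = 1 ∧
    ((s.idx 6 = 0 ∧ s.var 4 = 1 ∧ ∀ k ∈ ({1, 2, 3} : Finset ℕ), MemA k f → ∀ j ≤ n, Agrees f s j) ∨
      (s.idx 6 = 1 ∧ s.var 4 = 0 ∧ s.var 5 = 1 ∧ s.var 8 = 0 ∧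
        ∀ k ∈ ({1, 2, 3} : Finset ℕ), MemA k f → ∀ j < n, Agrees f s j))

/-- The state before the loop. -/
structure Prepared {n : ℕ} (f : Fin (n + 1) → ℂ) (s : State) : Prop where
  idx_zero : s.idx 0 = n
  idx_one : s.idx 1 = 0
  idx_two : s.idx 2 = 0
  idx_three : s.idx 3 = 0
  idx_four : s.idx 4 = 0
  idx_five : s.idx 5 = 0
  idx_seven : s.idx 7 = 2
  idx_eight : s.idx 8 = 0
  arr : s.arr = entry f
  uu : s.var 10 = dot₂ ![s.var 4, s.var 5] ![s.var 4, s.var 5]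
  vv : s.var 11 = dot₂ ![s.var 6, s.var 7] ![s.var 6, s.var 7]
  uv : s.var 12 = dot₂ ![s.var 4, s.var 5] ![s.var 6, s.var 7]
  ratio : s.var 13 = s.var 11 / s.var 10
  sign : s.var 14 = -1
  left : s.var 15 = s.var 8
  right : s.var 16 = s.var 9
  ratioPow : s.var 17 = 1
  signPow : s.var 18 = 1
  scratch : s.var 19 = 1
  var_thirty : s.var 30 = 0
  candidate : Candidate f s

section
variable {n : ℕ} (f : Fin (n + 1) → ℂ)

/-- Membership in any class supplies a decomposition, whose vanishing minor forces the entries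
before the last to be geometric. The coefficient of (0,1) stays 0 until the last entry is read. -/
lemma candidate_infiniteSlope (hn : 3 ≤ n)
    (h : ((setup.run (inputState f)).var 24 = 0)) :
    Candidate f (infiniteSlope.run (setup.run (inputState f))) := by
  refine ⟨rfl, Or.inr ⟨rfl, rfl, rfl, rfl, fun k hk hf j hj => ?_⟩⟩
  have h24 : (setup.run (inputState f)).var 24 =
    entry f 0 * entry f 2 - entry f 1 * entry f 1 := rfl
  obtain ⟨c₁, u, c₂, v, hd⟩ := hf.exists_decomposes hk
  have key := hd.eq_of_hankel_eq_zero hn (by rw [sq, ← h24, h]) j hj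
  have h7 : (infiniteSlope.run (setup.run (inputState f))).var 7 = entry f 1 / entry f 0 := rfl
  have h8 : (infiniteSlope.run (setup.run (inputState f))).var 8 = 0 := rfl
  have h9 : (infiniteSlope.run (setup.run (inputState f))).var 9 = entry f 0 + 0 := rfl
  rw [Agrees, h7, h8, h9, key]
  ring

lemma candidate_finiteSlopes (hn : 3 ≤ n)
    (h : ((setup.run (inputState f)).var 24 ≠ 0)) :
    Candidate f (finiteSlopes.run (setup.run (inputState f))) := by
  refine ⟨rfl, Or.inl ⟨rfl, rfl, fun k hk hf j hj => ?_⟩⟩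
  have h24 : (setup.run (inputState f)).var 24 =
    entry f 0 * entry f 2 - entry f 1 * entry f 1 := rfl
  have h20 : (setup.run (inputState f)).var 20 = entry f 0 := rfl
  have h21 : (setup.run (inputState f)).var 21 = entry f 1 := rfl
  have h22 : (setup.run (inputState f)).var 22 = entry f 2 := rfl
  have h23 : (setup.run (inputState f)).var 23 = entry f 3 := rfl
  have h30 : (setup.run (inputState f)).var 30 = 0 := rfl
  have hi7 : (setup.run (inputState f)).idx 7 = 2 := rfl
  generalize setup.run (inputState f) = s at *
  obtain ⟨c₁, u, c₂, v, hd⟩ := hf.exists_decomposes hk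
  set c := s.var 24
  set b := s.var 21 * s.var 22 - s.var 20 * s.var 23 with hb
  set a := s.var 21 * s.var 23 - s.var 22 * s.var 22 with ha
  set δ := (b * b - (a * c + a * c + (a * c + a * c))) ^ ((s.idx 7 : ℂ)⁻¹) with hδ
  have h5 : (finiteSlopes.run s).var 5 = (s.var 30 - b + δ) / (c + c) := rfl
  have h7 : (finiteSlopes.run s).var 7 = (s.var 30 - b - δ) / (c + c) := rfl
  have h8 : (finiteSlopes.run s).var 8 = (s.var 21 - s.var 20 * (finiteSlopes.run s).var 7) /
    ((finiteSlopes.run s).var 5 - (finiteSlopes.run s).var 7) := rfl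
  have h9 : (finiteSlopes.run s).var 9 = s.var 20 - (finiteSlopes.run s).var 8 := rfl
  rw [h30, zero_sub, ← two_mul] at h5 h7
  rw [h20, h21] at h8
  rw [h20] at h9
  rw [Agrees, h9]
  refine hd.eq_of_hankel_ne_zero hn (c := c) (b := b) (a := a) (δ := δ) (by rw [h24, sq]) h
    (by rw [hb, h20, h21, h22, h23]) (by rw [ha, h21, h22, h23, sq]) ?_ h5 h7 h8 j hj
  rw [hδ, sqrt_sq _ hi7]
  ring

lemma prepared_precompute (hn : 3 ≤ n) : Prepared f (precompute.run (inputState f)) := by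
  have key : ∀ s : State, s.idx 0 = n → s.idx 1 = 0 → s.idx 2 = 0 → s.idx 3 = 0 → s.idx 4 = 0 →
      s.idx 5 = 0 → s.idx 7 = 2 → s.arr = entry f → s.var 30 = 0 → Candidate f s →
      Prepared f (prepare.run s) := by
    intro s h0 h1 h2 h3 h4 h5 h7 harr h30 hc
    have ha : (prepare.run s).arr = s.arr := by
      simp only [prepare, block, skip, Program.run, Instr.next]
    have h14 : (prepare.run s).var 14 = s.var 30 - 1 := rfl
    have h15 : (prepare.run s).var 15 = s.var 8 + s.var 30 := rfl
    have h16 : (prepare.run s).var 16 = s.var 9 + s.var 30 := rfl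
    exact
      { idx_zero := h0, idx_one := h1, idx_two := h2, idx_three := h3, idx_four := h4,
        idx_five := h5, idx_seven := h7, idx_eight := rfl, arr := ha.trans harr, uu := rfl, vv := rfl,
        uv := rfl, ratio := rfl
        sign := by rw [h14, h30, zero_sub]
        left := by rw [h15, h30, add_zero]; rfl
        right := by rw [h16, h30, add_zero]; rfl
        ratioPow := rfl, signPow := rfl, scratch := rfl, var_thirty := h30, candidate := hc }
  rw [precompute, Program.run, Program.run, run_branch]
  split_ifs with h
  · exact key (infiniteSlope.run (setup.run (inputState f))) rfl rfl rfl rfl rfl rfl rfl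
      (by simp only [setup, infiniteSlope, block, skip, Program.run, Instr.next, entry]) rfl
      (candidate_infiniteSlope f hn h)
  · exact key (finiteSlopes.run (setup.run (inputState f))) rfl rfl rfl rfl rfl rfl rfl
      (by simp only [setup, finiteSlopes, block, skip, Program.run, Instr.next, entry]) rfl
      (candidate_finiteSlopes f hn h)

end

/-! ### The comparison loop -/

/-- The state after `j` iterations of the loop started in the state `s`. -/
structure LoopInv {n : ℕ} (f : Fin (n + 1) → ℂ) (s : State) (j : ℕ) (s' : State) : Prop where
  idx_four : s'.idx 4 = j
  idx_five_le : s'.idx 5 ≤ 1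
  idx_five : s'.idx 5 = 0 ↔ ∀ i < j, Agrees f s i
  idx (i : ℕ) : i ≠ 4 → i ≠ 5 → s'.idx i = s.idx i
  arr : s'.arr = s.arr
  left : s'.var 15 = s.var 8 * s.var 5 ^ j
  right : s'.var 16 = s.var 9 * s.var 7 ^ j
  ratioPow : s'.var 17 = s.var 13 ^ j
  signPow : s'.var 18 = s.var 14 ^ j
  scratch : s'.var 19 = 1
  var (x : ℕ) : x < 15 ∨ 19 < x → s'.var x = s.var x

lemma Prepared.loopInv_zero {n : ℕ} {f : Fin (n + 1) → ℂ} {s : State} (h : Prepared f s) :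
    LoopInv f s 0 s where
  idx_four := h.idx_four
  idx_five_le := by rw [h.idx_five]; exact Nat.zero_le _
  idx_five := by simp [h.idx_five]
  idx _ _ _ := rfl
  arr := rfl
  left := by rw [h.left, pow_zero, mul_one]
  right := by rw [h.right, pow_zero, mul_one]
  ratioPow := by rw [h.ratioPow, pow_zero]
  signPow := by rw [h.signPow, pow_zero]
  scratch := h.scratch
  var _ _ := rfl

lemma Prepared.loopInv_succ {n : ℕ} {f : Fin (n + 1) → ℂ} {s s' : State} {j : ℕ}
    (h : Prepared f s) (hs : LoopInv f s j s') : LoopInv f s (j + 1) (compareEntry.run s') := by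
  set s₁ := (block [.load 19 4, .arith .sub 19 19 15, .arith .sub 19 19 16]).run s' with hs₁
  have h19 : s₁.var 19 = 0 ↔ Agrees f s j := by
    have : s₁.var 19 = s'.arr (s'.idx 4) - s'.var 15 - s'.var 16 := rfl
    rw [this, hs.arr, hs.idx_four, hs.left, hs.right, h.arr, Agrees, sub_sub, sub_eq_zero]
  have key : ∀ s₂ : State, s₂.arr = s'.arr → (∀ i, i ≠ 5 → s₂.idx i = s'.idx i) → s₂.idx 5 ≤ 1 →
      (s₂.idx 5 = 0 ↔ s'.idx 5 = 0 ∧ Agrees f s j) → (∀ x, x ≠ 19 → s₂.var x = s'.var x) →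
      LoopInv f s (j + 1) ((block [.one 19, .arith .mul 15 15 5, .arith .mul 16 16 7,
        .arith .mul 17 17 13, .arith .mul 18 18 14, .idxInc 4]).run s₂) := by
    intro s₂ harr hidx h5 h5' hvar
    have h8 := h.idx_eight
    constructor
    · change s₂.idx 4 + 1 = j + 1
      rw [hidx 4 (by norm_num), hs.idx_four]
    · exact h5
    · change s₂.idx 5 = 0 ↔ _
      rw [h5', hs.idx_five, Nat.forall_lt_succ_right]
    · intro i hi4 hi5
      -- The block ends with `skip`, which resets register 8; this is harmless because it already
      -- holds 0.
      by_cases hi8 : i = 8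
      · subst hi8; exact h8.symm
      · rw [← hs.idx i hi4 hi5, ← hidx i hi5]
        simp [block, skip, Program.run, Instr.next, hi4, hi8]
    · exact harr.trans hs.arr
    · change s₂.var 15 * s₂.var 5 = _
      rw [hvar 15 (by norm_num), hvar 5 (by norm_num), hs.left, hs.var 5 (by norm_num)]
      ring
    · change s₂.var 16 * s₂.var 7 = _
      rw [hvar 16 (by norm_num), hvar 7 (by norm_num), hs.right, hs.var 7 (by norm_num)]
      ring
    · change s₂.var 17 * s₂.var 13 = _
      rw [hvar 17 (by norm_num), hvar 13 (by norm_num), hs.ratioPow, hs.var 13 (by norm_num)]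
      ring
    · change s₂.var 18 * s₂.var 14 = _
      rw [hvar 18 (by norm_num), hvar 14 (by norm_num), hs.signPow, hs.var 14 (by norm_num)]
      ring
    · rfl
    · intro x hx
      rw [← hs.var x hx, ← hvar x (by omega)]
      have h1 : x ≠ 15 := by omega
      have h2 : x ≠ 16 := by omega
      have h3 : x ≠ 17 := by omega
      have h4 : x ≠ 18 := by omega
      have h5 : x ≠ 19 := by omega
      simp [block, skip, Program.run, Instr.next, h1, h2, h3, h4, h5]
  have h8 : s'.idx 8 = 0 := (hs.idx 8 (by norm_num) (by norm_num)).trans h.idx_eight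
  have hidx₁ : ∀ i, s₁.idx i = s'.idx i := by
    intro i
    by_cases hi : i = 8
    · subst hi; exact h8.symm
    · simp [hs₁, block, skip, Program.run, Instr.next, hi]
  have hvar₁ : ∀ x, x ≠ 19 → s₁.var x = s'.var x := by
    intro x hx
    simp [hs₁, block, skip, Program.run, Instr.next, hx]
  rw [compareEntry, Program.run, Program.run, run_branch, ← hs₁]
  split_ifs with ht
  · refine key _ rfl (fun i hi => ?_) ?_ ?_ hvar₁
    · by_cases hi8 : i = 8
      · subst hi8; exact h8.symm
      · simp [skip, Program.run, Instr.next, hi8, hidx₁]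
    · change s₁.idx 5 ≤ 1
      rw [hidx₁]; exact hs.idx_five_le
    · change s₁.idx 5 = 0 ↔ _
      rw [hidx₁, and_iff_left (h19.mp ht)]
  · refine key _ rfl (fun i hi => ?_) ?_ ?_ hvar₁
    · by_cases hi8 : i = 8
      · subst hi8; exact h8.symm
      · simp [block, skip, Program.run, Instr.next, hi8, hi, hidx₁]
    · exact le_rfl
    · exact iff_of_false (Nat.succ_ne_zero 0) fun h => ht (h19.mpr h.2)

lemma Prepared.loopInv {n : ℕ} {f : Fin (n + 1) → ℂ} {s : State} (h : Prepared f s) (j : ℕ) :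
    LoopInv f s j (compareEntry.run^[j] s) := by
  induction j with
  | zero => exact h.loopInv_zero
  | succ j ih =>
    rw [Function.iterate_succ_apply']
    exact h.loopInv_succ ih

/-- The bound uses the closed forms: one power and one product above the initial level, whatever j
is. Iterating the bound for a single round would apply `grow` a number of times depending on j.
Resetting the scratch register each round keeps it covered too. -/
lemma LoopInv.bounds {n : ℕ} {f : Fin (n + 1) → ℂ} {s s' : State} {j : ℕ} (hs : LoopInv f s j s')
    {w : ℂ → ℕ} {N k : ℕ} {M : SizeModel w N} (hk : 3 ≤ k) (hM : M.Bounds k s) (hj : j ≤ N) :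
    M.Bounds (grow (grow k)) s' := by
  have hk1 := le_grow k
  have hk2 := le_grow (grow k)
  have hN : N ≤ (N + 2) ^ k := le_trans (by omega) (Nat.le_self_pow (show k ≠ 0 by omega) (N + 2))
  have hpow : ∀ x, M.lvl (grow k) (s.var x ^ j) := fun x => M.pow (hM.var x) (hj.trans hN)
  have hM' := hM.mono (hk1.trans hk2)
  refine ⟨fun x => ?_, fun i => ?_, fun i => ?_⟩
  · by_cases hx : x < 15 ∨ 19 < x
    · rw [hs.var x hx]
      exact hM'.var x
    · obtain rfl | rfl | rfl | rfl | rfl : x = 15 ∨ x = 16 ∨ x = 17 ∨ x = 18 ∨ x = 19 := by omega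
      · rw [hs.left]
        exact M.arith .mul ((hM.mono hk1).var 8) (hpow 5)
      · rw [hs.right]
        exact M.arith .mul ((hM.mono hk1).var 9) (hpow 7)
      · rw [hs.ratioPow]
        exact M.mono (hpow 13) hk2
      · rw [hs.signPow]
        exact M.mono (hpow 14) hk2
      · rw [hs.scratch]
        exact M.mono M.one (by omega)
  · rw [hs.arr]
    exact hM'.arr i
  · by_cases h4 : i = 4
    · rw [h4, hs.idx_four]
      exact (hj.trans hN).trans (Nat.pow_le_pow_right (by omega) (hk1.trans hk2))
    · by_cases h5 : i = 5
      · rw [h5]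
        exact hs.idx_five_le.trans (Nat.one_le_pow _ _ (by omega))
      · rw [hs.idx i h4 h5]
        exact hM'.idx i

/-- If the flag is clear, the candidate sums to f, and non-degeneracy makes it a decomposition that
can be classified. If it is set, no class contains f, since a member would have agreed. For u =
(0,1) the last entry is not a test: its residue is the missing coefficient. -/
lemma Prepared.correct_finish {n : ℕ} {f : Fin (n + 1) → ℂ} {s s' : State} (hn : 3 ≤ n)
    (hf : ¬ IsDegenerate (symm f)) (h : Prepared f s) (hs : LoopInv f s n s') :
    Correct f (finish.run s') := by
  have hidx : ∀ i, i ≠ 4 → i ≠ 5 → s'.idx i = s.idx i := hs.idx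
  have h8 : s'.idx 8 = 0 := (hidx 8 (by norm_num) (by norm_num)).trans h.idx_eight
  set s₁ := (block [.load 19 4, .arith .sub 19 19 15, .arith .sub 19 19 16]).run s' with hs₁
  have h19 : s₁.var 19 = entry f n - s.var 8 * s.var 5 ^ n - s.var 9 * s.var 7 ^ n := by
    have : s₁.var 19 = s'.arr (s'.idx 4) - s'.var 15 - s'.var 16 := rfl
    rw [this, hs.arr, hs.idx_four, hs.left, hs.right, h.arr]
  have hidx₁ : ∀ i, i ≠ 4 → i ≠ 5 → s₁.idx i = s.idx i := by
    intro i h4 h5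
    by_cases hi : i = 8
    · subst hi; exact h.idx_eight.symm
    · rw [← hidx i h4 h5]
      simp [hs₁, block, skip, Program.run, Instr.next, hi]
  have hvar₁ : ∀ x, x < 15 ∨ 19 < x → s₁.var x = s.var x := by
    intro x hx
    rw [← hs.var x hx]
    simp [hs₁, block, skip, Program.run, Instr.next, show x ≠ 19 by omega]
  have h5 : s₁.idx 5 = 0 ↔ ∀ i < n, Agrees f s i := hs.idx_five
  have h17 : s₁.var 17 = s.var 13 ^ n := hs.ratioPow
  have h18 : s₁.var 18 = s.var 14 ^ n := hs.signPow
  have key : ∀ s₂ : State, (∀ i, i ≠ 4 → i ≠ 5 → s₂.idx i = s.idx i) →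
      (∀ x, x ≠ 8 → s₂.var x = s₁.var x) →
      (∀ k ∈ ({1, 2, 3} : Finset ℕ), MemA k f → s₂.idx 5 = 0) →
      (s₂.idx 5 = 0 → IsSum f (s₂.var 8) ![s₂.var 4, s₂.var 5] (s₂.var 9) ![s₂.var 6, s₂.var 7]) →
      Correct f ((Program.branch (.idxEq 5 8) classify skip).run s₂) := by
    intro s₂ hi hv hmem hsum
    have hv' : ∀ x, x ≠ 8 → (x < 15 ∨ 19 < x) → s₂.var x = s.var x := fun x h8 hx =>
      (hv x h8).trans (hvar₁ x hx)
    have hi8 : s₂.idx 8 = 0 := (hi 8 (by norm_num) (by norm_num)).trans h.idx_eight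
    have h1 : s₂.idx 1 = 0 := (hi 1 (by norm_num) (by norm_num)).trans h.idx_one
    have h2 : s₂.idx 2 = 0 := (hi 2 (by norm_num) (by norm_num)).trans h.idx_two
    have h3 : s₂.idx 3 = 0 := (hi 3 (by norm_num) (by norm_num)).trans h.idx_three
    rw [run_branch]
    split_ifs with ht
    · refine Decomposed.correct_classify hn
        { idx_zero := (hi 0 (by norm_num) (by norm_num)).trans h.idx_zero
          idx_one := h1, idx_two := h2, idx_three := h3
          idx_seven := (hi 7 (by norm_num) (by norm_num)).trans h.idx_seven
          var_thirty := (hv' 30 (by norm_num) (by norm_num)).trans h.var_thirty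
          decomposes := (hsum (Eq.trans ht hi8)).decomposes (by omega) hf
          uu := ?_, vv := ?_, uv := ?_, ratio := ?_, sign := ?_, slope := ?_ }
      · rw [hv' 10 (by norm_num) (by norm_num), hv' 4 (by norm_num) (by norm_num),
          hv' 5 (by norm_num) (by norm_num), h.uu]
      · rw [hv' 11 (by norm_num) (by norm_num), hv' 6 (by norm_num) (by norm_num),
          hv' 7 (by norm_num) (by norm_num), h.vv]
      · rw [hv' 12 (by norm_num) (by norm_num), hv' 4 (by norm_num) (by norm_num),
          hv' 5 (by norm_num) (by norm_num), hv' 6 (by norm_num) (by norm_num),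
          hv' 7 (by norm_num) (by norm_num), h.uv]
      · rw [hv' 10 (by norm_num) (by norm_num), hv' 11 (by norm_num) (by norm_num),
          hv 17 (by norm_num), h17, h.ratio]
      · rw [hv 18 (by norm_num), h18, h.sign]
      · rw [hv' 10 (by norm_num) (by norm_num), hv' 4 (by norm_num) (by norm_num),
          hv' 6 (by norm_num) (by norm_num)]
        refine ⟨h.candidate.1, fun h0 => ?_⟩
        rcases h.candidate.2 with hc | hc
        · exact hc.2.1
        -- For u = (0,1) one has u·u = 1, so an isotropic u always comes with first coordinate 1, as
        -- `memAWith_two` requires.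
        · exact absurd h0 (by rw [h.uu, hc.2.1, hc.2.2.1]; norm_num [dot₂])
    · exact correct_of_not_memA (fun k hk hm => ht ((hmem k hk hm).trans hi8.symm)) h1 h2 h3
  have h8' := h.idx_eight
  have hlast : entry f n = f (Fin.last n) := congrFun (entry_coe f) (Fin.last n)
  have hent : ∀ j : Fin (n + 1), entry f j = f j := fun j => congrFun (entry_coe f) j
  rw [finish, Program.run, lastEntry, Program.run, ← hs₁]
  rcases h.candidate with ⟨hv6, ⟨hi6, hv4, hc⟩ | ⟨hi6, hv4, hv5, hv8, hc⟩⟩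
  · have hb : (Test.idxEq 6 8).Holds s₁ := by
      rw [Test.Holds, hidx₁ 6 (by norm_num) (by norm_num), hidx₁ 8 (by norm_num) (by norm_num),
        hi6, h8']
    rw [run_branch (.idxEq 6 8), if_pos hb, run_branch (.isZero 19)]
    have hzero : (Test.isZero 19).Holds s₁ ↔ Agrees f s n := by
      rw [Test.Holds, h19, Agrees, sub_sub, sub_eq_zero]
    split_ifs with ht
    · refine key _ (fun i h4 h5 => ?_) (fun _ _ => rfl) (fun k hk hm => ?_) fun h0 => ?_
      · by_cases hi : i = 8
        · subst hi; exact h8'.symm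
        · rw [← hidx₁ i h4 h5]
          simp [skip, Program.run, Instr.next, hi]
      · exact h5.mpr fun i hi => hc k hk hm i hi.le
      · change IsSum f (s₁.var 8) ![s₁.var 4, s₁.var 5] (s₁.var 9) ![s₁.var 6, s₁.var 7]
        rw [hvar₁ 4 (by norm_num), hvar₁ 5 (by norm_num), hvar₁ 6 (by norm_num),
          hvar₁ 7 (by norm_num), hvar₁ 8 (by norm_num), hvar₁ 9 (by norm_num)]
        refine IsSum.of_affine hv4 hv6 fun j => ?_
        rw [← hent j]
        rcases Nat.lt_succ_iff_lt_or_eq.mp j.2 with hj | hj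
        · exact h5.mp h0 j hj
        · rw [hj]; exact hzero.mp ht
    · refine key _ (fun i h4 h5 => ?_) (fun _ _ => rfl) (fun k hk hm => ?_) fun h0 => ?_
      · rw [← hidx₁ i h4 h5]
        simp [Program.run, Instr.next, h5]
      · exact absurd (hzero.mpr (hc k hk hm n le_rfl)) ht
      · exact absurd h0 (Nat.succ_ne_zero _)
  · have hb : ¬ (Test.idxEq 6 8).Holds s₁ := by
      rw [Test.Holds, hidx₁ 6 (by norm_num) (by norm_num), hidx₁ 8 (by norm_num) (by norm_num),
        hi6, h8']
      exact one_ne_zero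
    rw [run_branch (.idxEq 6 8), if_neg hb]
    refine key _ hidx₁ (fun x hx => ?_) (fun k hk hm => ?_) fun h0 => ?_
    · simp [Program.run, Instr.next, hx]
    · exact h5.mpr fun i hi => hc k hk hm i hi
    · change IsSum f (s₁.var 19 + s₁.var 30) ![s₁.var 4, s₁.var 5] (s₁.var 9)
        ![s₁.var 6, s₁.var 7]
      rw [hvar₁ 4 (by norm_num), hvar₁ 5 (by norm_num), hvar₁ 6 (by norm_num),
        hvar₁ 7 (by norm_num), hvar₁ 9 (by norm_num), hvar₁ 30 (by norm_num)]
      refine IsSum.of_infinite hv4 hv5 hv6 (fun j hj => ?_) ?_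
      · rw [← hent j, h5.mp h0 j hj, hv8]
        simp
      · rw [h19, hv8, h.var_thirty, hlast]
        simp

/-! ### Polynomial running time -/

lemma bounds_inputState {n : ℕ} {f : Fin (n + 1) → ℂ} {w : ℂ → ℕ} {N : ℕ} (M : SizeModel w N)
    (hn : n ≤ N) (hf : ∀ j, M.lvl 3 (f j)) : M.Bounds 3 (inputState f) := by
  refine ⟨fun _ => M.zero, fun j => ?_, fun i => ?_⟩
  · unfold inputState
    dsimp only
    split_ifs with hj
    · exact hf _
    · exact M.zero
  · unfold inputState
    dsimp only
    split_ifs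
    · exact hn.trans (le_trans (by omega) (Nat.le_self_pow (show 3 ≠ 0 by omega) (N + 2)))
    · exact Nat.zero_le _

/-- The final state of the algorithm. -/
def finalState {n : ℕ} (f : Fin (n + 1) → ℂ) : State :=
  finish.run (compareEntry.run^[n] (precompute.run (inputState f)))

/-- K is fixed before the input and the cost model, and the final state does not depend on the
weight. -/
theorem exists_runs_decideA :
    ∃ K, ∀ (n : ℕ) (f : Fin (n + 1) → ℂ), 3 ≤ n → ∀ (w : ℂ → ℕ) (N : ℕ) (M : SizeModel w N),
      n ≤ N → (∀ j, M.lvl 3 (f j)) →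
        ∃ t, Runs w decideA (inputState f) (finalState f) t ∧ t ≤ (N + 2) ^ K := by
  obtain ⟨K₁, h₁⟩ := loopFree_precompute.exists_runs 3
  -- The two applications of `grow` come from `LoopInv.bounds`, which needs a level of at least 3;
  -- this is the reason for K₁ + 3.
  obtain ⟨K₂, h₂⟩ := loopFree_compareEntry.exists_runs_loopUntil (grow (grow (K₁ + 3)))
  obtain ⟨K₃, h₃⟩ := loopFree_finish.exists_runs K₂
  refine ⟨K₁ + K₂ + K₃ + 2, fun n f hn w N M hN hf => ?_⟩
  have hP := prepared_precompute f hn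
  obtain ⟨hB₁, t₁, ht₁, hle₁⟩ := h₁ w N M _ (bounds_inputState M hN hf)
  have htest : ∀ j, (Test.idxEq 4 0).Holds (compareEntry.run^[j] (precompute.run (inputState f))) ↔
      j = n := fun j => by
    rw [Test.Holds, (hP.loopInv j).idx_four, (hP.loopInv j).idx 0 (by norm_num) (by norm_num),
      hP.idx_zero]
  obtain ⟨hB₂, t₂, ht₂, hle₂⟩ := h₂ w N M (.idxEq 4 0) n (precompute.run (inputState f)) hN
    (fun j hj h => hj.ne ((htest j).mp h)) ((htest n).mpr rfl)
    (fun j hj => (hP.loopInv j).bounds (by omega) (hB₁.mono (by omega)) (hj.trans hN))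
  obtain ⟨-, t₃, ht₃, hle₃⟩ := h₃ w N M _ hB₂
  refine ⟨_, .comp ht₁ (.comp ht₂ ht₃), ?_⟩
  have e : ∀ k ≤ K₁ + K₂ + K₃, (N + 2) ^ k ≤ (N + 2) ^ (K₁ + K₂ + K₃) := fun k hk =>
    Nat.pow_le_pow_right (by omega) hk
  have e₁ := e K₁ (by omega)
  have e₂ := e K₂ (by omega)
  have e₃ := e K₃ (by omega)
  calc t₁ + (t₂ + t₃) ≤ (N + 2) ^ (K₁ + K₂ + K₃) * 4 := by omega
    _ ≤ (N + 2) ^ (K₁ + K₂ + K₃) * (N + 2) ^ 2 := Nat.mul_le_mul_left _ (by nlinarith)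
    _ = _ := by rw [← pow_add]

theorem correct_finalState {n : ℕ} {f : Fin (n + 1) → ℂ} (hn : 3 ≤ n)
    (hf : ¬ IsDegenerate (symm f)) : Correct f (finalState f) :=
  (prepared_precompute f hn).correct_finish hn hf ((prepared_precompute f hn).loopInv n)

end

end Holant

end

/-! ### The two cost measures combined -/

theorem mainTheorem1 :
    (∀ (n : ℕ) (f : Fin (n + 1) → ℂ), 3 ≤ n → ¬ Holant.IsDegenerate (Holant.symm f) →
      ∀ j ∈ ({1, 2, 3} : Finset ℕ), ∀ k ∈ ({1, 2, 3} : Finset ℕ),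
        Holant.MemA j f → Holant.MemA k f → j = k) ∧
    ∃ (prog : Holant.Program) (p : Polynomial ℕ),
      ∀ (n : ℕ) (f : Fin (n + 1) → ℂ), 3 ≤ n → ¬ Holant.IsDegenerate (Holant.symm f) →
        ∃ s : Holant.State,
          (∃ t : ℕ, Holant.Runs Holant.unitWeight prog (Holant.inputState f) s t ∧
            t ≤ p.eval n) ∧
          ((∀ i, IsAlgebraic ℚ (f i)) →
            ∃ t : ℕ, Holant.Runs Holant.bitSize prog (Holant.inputState f) s t ∧
              t ≤ p.eval (n + ∑ i, Holant.bitSize (f i))) ∧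
          ∀ k ∈ ({1, 2, 3} : Finset ℕ),
            (Holant.MemA k f → s.idx k = 1 ∧ Holant.MemAWith k f s.outputMatrix) ∧
            (¬ Holant.MemA k f → s.idx k = 0) := by
  refine ⟨fun n f hn _ j hj k hk => Holant.eq_of_memA hn hj hk, ?_⟩
  obtain ⟨K, hK⟩ := Holant.exists_runs_decideA
  refine ⟨Holant.decideA, (Polynomial.X + 2) ^ K, fun n f hn hf =>
    ⟨Holant.finalState f, ?_, fun halg => ?_, Holant.correct_finalState hn hf⟩⟩
  · simpa using hK n f hn _ n (Holant.unitModel n) le_rfl fun _ => trivial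
  -- The size parameter is n plus all bit sizes, so each single entry has bit size at most N ≤ (N +
  -- 2)³.
  · have hbits : ∀ j, (Holant.bitModel (n + ∑ i, Holant.bitSize (f i))).lvl 3 (f j) := by
      intro j
      refine (Holant.bitBound_bitSize (halg j)).mono ?_
      have h1 := Finset.single_le_sum (f := fun i => Holant.bitSize (f i))
        (fun _ _ => Nat.zero_le _) (Finset.mem_univ j)
      exact le_trans (by omega) (Nat.le_self_pow (by norm_num) _)
    simpa using hK n f hn _ _ (Holant.bitModel _) (Nat.le_add_right _ _) hbits
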